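/- **Theorem (weak posterior consistency).** Let $n\ge p\ge 1$ and $C\ge 1$ be integers. Let $\mathcal V_{n,p}=\{X\in\mathbb R^{n\times p}: X^TX=I_p\}$ be the Stiefel manifold with its normalized Haar (uniform) probability measure $[dX]$, let $\widetilde{\mathcal V}_{n,p}\subset\mathcal V_{n,p}$ be the set of matrices whose first row has only positive entries, let $\mathcal S_p=\{d\in\mathbb R^p: 0<d_p<\dots<d_1\}$, and let $\mathbb S_\pi=\{\pi\in\mathbb R^C:\pi_c>0,\ \sum_c\pi_c=1\}$. For $d\in\mathbb R^p$ and $D=\mathrm{diag}(d)$ write $${}_0F_1\!\left(\tfrac n2,\tfrac{D^2}{4}\right)=\int_{\mathcal V_{n,p}}\exp\Big(\sum_{j=1}^p d_jX_{jj}\Big)[dX],\qquad f_{\mathcal{ML}}(X;(M,d,V))=\frac{\exp\big(\mathrm{tr}(VDM^TX)\big)}{{}_0F_1(n/2,D^2/4)}$$ for the normalizing constant (a hypergeometric function of matrix argument) and for the matrix Langevin density on $\mathcal V_{n,p}$ with respect to $[dX]$, where $M\in\mathcal V_{n,p}$ and $V\in\mathcal V_{p,p}$. Let $\Xi=(\widetilde{\mathcal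 V}_{n,p}\times\mathcal S_p\times\mathcal V_{p,p})^C\times\mathbb S_\pi$ and, for $(\theta,\pi)\in\Xi$ with $\theta=(M_c,d_c,V_c)_{c\le C}$, let $f_{\theta,\pi}(X)=\sum_{c=1}^C\pi_c f_{\mathcal{ML}}(X;(M_c,d_c,V_c))$, and let $F_{\theta,\pi}$ be the probability distribution on $\mathcal V_{n,p}$ with density $f_{\theta,\pi}$. Let the prior $\Pi$ be the probability distribution on $\Xi$ under which all of $M_1,\dots,M_C,d_1,\dots,d_C,V_1,\dots,V_C,\pi$ are independent and, for each $c$, * $M_c$ has a matrix Langevin distribution on $\mathcal V_{n,p}$ (with parameters in $\mathcal V_{n,p}\times\mathbb R^p\times\mathcal V_{p,p}$, which may depend on $c$), restricted to $\widetilde{\mathcal V}_{n,p}$ and renormalized; * $d_c$ has Lebesgue density on $\mathcal S_p$ proportional to $\exp(\nu_c\,\eta_c^Td)\big/\big[{}_0F_1(n/2,D^2/4)\big]^{\nu_c}$ (the IMDY prior restricted to $\mathcal S_p$), where $\nu_c>0$ and $\eta_c\in\mathbb R^p$ has $\max_j\eta_{c,j}<1$; * $V_c$ has a matrix Langevin distribution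 on $\mathcal V_{p,p}$ (with parameters in $\mathcal V_{p,p}\times\mathbb R^p\times\mathcal V_{p,p}$, which may depend on $c$); and $\pi\sim\mathrm{Dirichlet}(\alpha_1,\dots,\alpha_C)$ with all $\alpha_c>0$. Let $(\theta_0,\pi_0)\in\Xi$. For $X_1,X_2,\dots\in\mathcal V_{n,p}$ and $N\ge 0$ put $R_N(\theta,\pi)=\prod_{i=1}^N f_{\theta,\pi}(X_i)/f_{\theta_0,\pi_0}(X_i)$ and $$\Pi(A\mid X_1,\dots,X_N)=\frac{\int_A R_N\,d\Pi}{\int_\Xi R_N\,d\Pi}.$$ Call $\mathcal U\subseteq\Xi$ a weak neighbourhood of $(\theta_0,\pi_0)$ if there are $\varepsilon>0$ and finitely many bounded continuous functions $g_1,\dots,g_k:\mathcal V_{n,p}\to\mathbb R$ such that $\mathcal U$ contains every $(\theta,\pi)\in\Xi$ with $\big|\int g_j f_{\theta_0,\pi_0}[dX]-\int g_j f_{\theta,\pi}[dX]\big|<\varepsilon$ for $j=1,\dots,k$. Then, for every weak neighbourhood $\mathcal U$ of $(\theta_0,\pi_0)$, for almost every sequence $(X_1,X_2,\dots)$ with respect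 to the infinite product measure $F_{\theta_0,\pi_0}^\infty$, the posterior is well defined (that is, $0<\int_\Xi R_N\,d\Pi<\infty$ for all $N$) and $$\Pi(\mathcal U^c\mid X_1,\dots,X_N)\longrightarrow 0\qquad(N\to\infty).$$ -/

import Mathlib

open MeasureTheory ProbabilityTheory Filter Topology
open scoped ENNReal BoundedContinuousFunction

namespace MatrixLangevin

/-! ### Matrices as a Borel space, the orthogonal group and its Haar measure -/

instance instMeasurableSpaceMat (n p : ℕ) : MeasurableSpace (Matrix (Fin n) (Fin p) ℝ) :=
  inferInstanceAs (MeasurableSpace (Fin n → Fin p → ℝ))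

instance instBorelSpaceMat (n p : ℕ) : BorelSpace (Matrix (Fin n) (Fin p) ℝ) :=
  inferInstanceAs (BorelSpace (Fin n → Fin p → ℝ))

/-- The orthogonal group `O(n)`. -/
abbrev OGroup (n : ℕ) : Type := Matrix.orthogonalGroup (Fin n) ℝ

instance instMeasurableSpaceOGroup (n : ℕ) : MeasurableSpace (OGroup n) :=
  Subtype.instMeasurableSpace

instance instBorelSpaceOGroup (n : ℕ) : BorelSpace (OGroup n) :=
  Subtype.borelSpace _

lemma abs_entry_le_one {n p : ℕ} {X : Matrix (Fin n) (Fin p) ℝ}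
    (hX : X.transpose * X = 1) (i : Fin n) (j : Fin p) : |X i j| ≤ 1 := by
  have h : ∑ k, X k j * X k j = 1 := by
    have := congrFun (congrFun hX j) j
    simpa [Matrix.mul_apply] using this
  have h2 : X i j * X i j ≤ 1 := by
    rw [← h]
    exact Finset.single_le_sum (f := fun k => X k j * X k j)
      (fun k _ => mul_self_nonneg _) (Finset.mem_univ i)
  exact abs_le_one_iff_mul_self_le_one.mpr h2

lemma isCompact_orthonormal (n p : ℕ) :
    IsCompact {X : Matrix (Fin n) (Fin p) ℝ | X.transpose * X = 1} := by
  have hK : IsCompact (Set.univ.pi fun _ : Fin n => Set.univ.pi fun _ : Fin p =>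
      Set.Icc (-1 : ℝ) 1) :=
    isCompact_univ_pi fun _ => isCompact_univ_pi fun _ => isCompact_Icc
  refine IsCompact.of_isClosed_subset (t := ?_) hK ?_ ?_
  · exact isClosed_singleton.preimage
      (f := fun X : Matrix (Fin n) (Fin p) ℝ => X.transpose * X) (by fun_prop)
  · intro X hX i _ j _
    exact abs_le.mp (abs_entry_le_one hX i j)

instance instCompactSpaceOGroup (n : ℕ) : CompactSpace (OGroup n) := by
  have h : IsCompact ((Matrix.orthogonalGroup (Fin n) ℝ : Submonoid _) :
      Set (Matrix (Fin n) (Fin n) ℝ)) := by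
    convert isCompact_orthonormal n n using 1
    ext X
    exact Matrix.mem_orthogonalGroup_iff' _ _
  exact isCompact_iff_compactSpace.mp h

/-- The normalized Haar measure of the compact group `O(n)`. -/
noncomputable def orthogonalHaar (n : ℕ) : Measure (OGroup n) :=
  Measure.haarMeasure ⊤

instance instIsHaarOrthogonalHaar (n : ℕ) : (orthogonalHaar n).IsHaarMeasure :=
  Measure.isHaarMeasure_haarMeasure _

instance instIsProbOrthogonalHaar (n : ℕ) : IsProbabilityMeasure (orthogonalHaar n) :=
  ⟨by
    have := Measure.haarMeasure_self (K₀ := (⊤ : TopologicalSpace.PositiveCompacts (OGroup n)))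
    simpa [orthogonalHaar] using this⟩

/-! ### The Stiefel manifold and its uniform distribution -/

/-- The Stiefel manifold `V_{n,p}` of `n × p` real matrices with orthonormal columns. -/
def stiefel (n p : ℕ) : Set (Matrix (Fin n) (Fin p) ℝ) :=
  {X | X.transpose * X = 1}

/-- The matrices in `V_{n,p}` whose first row is (entrywise) positive. -/
def stiefelPos (n p : ℕ) : Set (stiefel n p) :=
  {X | ∀ i : Fin n, (i : ℕ) = 0 → ∀ j, 0 < X.1 i j}

/-- The `n × p` matrix `I⋆ = [I_p ; 0]`. -/
def iStar (n p : ℕ) : Matrix (Fin n) (Fin p) ℝ :=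
  Matrix.of fun i j => if (i : ℕ) = (j : ℕ) then 1 else 0

lemma iStar_mem {n p : ℕ} (h : p ≤ n) : iStar n p ∈ stiefel n p := by
  ext j k
  simp only [iStar, Matrix.mul_apply, Matrix.transpose_apply, Matrix.of_apply,
    Matrix.one_apply]
  rw [Finset.sum_eq_single (Fin.castLE h j)]
  · simp [Fin.ext_iff]
  · intro i _ hi
    have : ¬ (i : ℕ) = (j : ℕ) := fun e => hi (Fin.ext (by simpa using e))
    simp [this]
  · simp

lemma orthogonal_mul_mem {n p : ℕ} (Q : OGroup n) {X : Matrix (Fin n) (Fin p) ℝ}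
    (hX : X ∈ stiefel n p) : Q.1 * X ∈ stiefel n p := by
  have hQ : Q.1.transpose * Q.1 = 1 := (Matrix.mem_orthogonalGroup_iff' _ _).mp Q.2
  change (Q.1 * X).transpose * (Q.1 * X) = 1
  rw [Matrix.transpose_mul, Matrix.mul_assoc, ← Matrix.mul_assoc _ Q.1 X, hQ, Matrix.one_mul]
  exact hX

/-- For `p ≤ n`, the map `O(n) → V_{n,p}` that keeps the first `p` columns. -/
def orbitMap {n p : ℕ} (h : p ≤ n) (Q : OGroup n) : stiefel n p :=
  ⟨Q.1 * iStar n p, orthogonal_mul_mem Q (iStar_mem h)⟩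

/-- The normalized Haar measure `[dX]` (the uniform distribution) on `V_{n,p}`, `p ≤ n`: the law of
the first `p` columns of a Haar distributed orthogonal matrix. If `n < p` then `V_{n,p}` is empty. -/
noncomputable def stiefelHaar (n p : ℕ) : Measure (stiefel n p) :=
  if h : p ≤ n then (orthogonalHaar n).map (orbitMap h) else 0

/-! ### Matrix Langevin distributions -/

/-- The value `₀F₁(n/2, D²/4)`, `D = diag d`, of the hypergeometric function of matrix argument,
through its integral representation `∫ etr(D I⋆ᵀ X) [dX]` over `V_{n,p}`. -/
noncomputable def hyp0F1 (n : ℕ) {p : ℕ} (d : Fin p → ℝ) : ℝ :=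
  ∫ X : stiefel n p, Real.exp (Matrix.trace (Matrix.diagonal d * (iStar n p).transpose * X.1))
    ∂(stiefelHaar n p)

/-- The matrix Langevin density
`f(X; (M, d, V)) = etr(V D Mᵀ X) / ₀F₁(n/2, D²/4)` with respect to `[dX]`. -/
noncomputable def mlDensity {n p : ℕ} (M : stiefel n p) (d : Fin p → ℝ) (V : stiefel p p)
    (X : stiefel n p) : ℝ :=
  Real.exp (Matrix.trace (V.1 * Matrix.diagonal d * M.1.transpose * X.1)) / hyp0F1 n d

/-- The matrix Langevin distribution `ML(·; M, d, V)` on `V_{n,p}`. -/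
noncomputable def mlLaw {n p : ℕ} (M : stiefel n p) (d : Fin p → ℝ) (V : stiefel p p) :
    Measure (stiefel n p) :=
  (stiefelHaar n p).withDensity fun X => ENNReal.ofReal (mlDensity M d V X)

/-! ### Parameter space and mixtures -/

/-- `S_p`, the set of `d` with `0 < d_p < ⋯ < d_1`. -/
def orderedCone (p : ℕ) : Set (Fin p → ℝ) :=
  {d | (∀ j, 0 < d j) ∧ StrictAnti d}

/-- The open simplex of mixture weights. -/
def openSimplex (C : ℕ) : Set (Fin C → ℝ) :=
  {w | (∀ c, 0 < w c) ∧ ∑ c, w c = 1}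

/-- The parameter `(M, d, V)` of one mixture component. -/
abbrev Param (n p : ℕ) : Type :=
  stiefelPos n p × orderedCone p × stiefel p p

/-- The parameter space `Ξ` of `C`-component mixtures: points `((M_c, d_c, V_c)_c, π)`. -/
abbrev MixParam (n p C : ℕ) : Type :=
  (Fin C → Param n p) × openSimplex C

/-- The mixture density `f(X; (θ, π)) = ∑_c π_c f(X; θ_c)`. -/
noncomputable def mixtureDensity {n p C : ℕ} (ξ : MixParam n p C) (X : stiefel n p) : ℝ :=
  ∑ c, ξ.2.1 c * mlDensity (ξ.1 c).1.1 (ξ.1 c).2.1.1 (ξ.1 c).2.2 X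

/-- The distribution `F_{θ,π}` on `V_{n,p}` with the mixture density. -/
noncomputable def mixtureLaw {n p C : ℕ} (ξ : MixParam n p C) : Measure (stiefel n p) :=
  (stiefelHaar n p).withDensity fun X => ENNReal.ofReal (mixtureDensity ξ X)

/-! ### The prior -/

/-- The `IMDY(·; ν, η)` distribution on `ℝ₊^p`: the probability measure with Lebesgue density
proportional to `exp(ν ηᵀd) / ₀F₁(n/2, D²/4)^ν`. -/
noncomputable def imdyLaw (n : ℕ) {p : ℕ} (ν : ℝ) (η : Fin p → ℝ) : Measure (Fin p → ℝ) :=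
  ProbabilityTheory.cond
    ((volume : Measure (Fin p → ℝ)).withDensity fun d =>
      ENNReal.ofReal (Real.exp (ν * ∑ j, η j * d j) / hyp0F1 n d ^ ν))
    {d | ∀ j, 0 < d j}

/-- The affine chart of `{w | ∑ w = 1}` whose coordinates are all weights but the first one. -/
def simplexChart (C : ℕ) [NeZero C] (x : {c : Fin C // c ≠ 0} → ℝ) : Fin C → ℝ :=
  fun c => if h : c = 0 then 1 - ∑ b, x b else x ⟨c, h⟩

/-- The Dirichlet distribution `Dir(α)`: the probability measure on the open simplex with density
proportional to `∏_c w_c ^ (α_c - 1)` with respect to Lebesgue measure. -/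
noncomputable def dirichletLaw {C : ℕ} [NeZero C] (α : Fin C → ℝ) : Measure (Fin C → ℝ) :=
  ProbabilityTheory.cond
    (((volume : Measure ({c : Fin C // c ≠ 0} → ℝ)).map (simplexChart C)).withDensity fun w =>
      ENNReal.ofReal (∏ c, w c ^ (α c - 1)))
    (openSimplex C)

/-- Hyperparameters of the independent prior; for each component, `ML` parameters for `M_c` and for
`V_c`, and `IMDY` parameters for `d_c`; finally the Dirichlet parameters. -/
structure Hyperparam (n p C : ℕ) where
  /-- orientation parameters of the prior of `M_c` -/
  MM : Fin C → stiefel n p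
  /-- concentrations of the prior of `M_c` -/
  MD : Fin C → Fin p → ℝ
  /-- right orientation parameters of the prior of `M_c` -/
  MV : Fin C → stiefel p p
  /-- orientation parameters of the prior of `V_c` -/
  VM : Fin C → stiefel p p
  /-- concentrations of the prior of `V_c` -/
  VD : Fin C → Fin p → ℝ
  /-- right orientation parameters of the prior of `V_c` -/
  VV : Fin C → stiefel p p
  /-- the scalar `IMDY` parameters -/
  ν : Fin C → ℝ
  /-- the vector `IMDY` parameters -/
  η : Fin C → Fin p → ℝ
  /-- the Dirichlet parameters -/
  α : Fin C → ℝ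

/-- The independent prior on `Ξ`: all `M_c ∼ ML`, `d_c ∼ IMDY`, `V_c ∼ ML` and `π ∼ Dir(α)` are
independent, where the laws of `M_c` and of `d_c` are conditioned to the parameter sets
`stiefelPos n p` and `orderedCone p` (the density is cut off there and renormalized). -/
noncomputable def prior {n p C : ℕ} [NeZero C] (H : Hyperparam n p C) :
    Measure (MixParam n p C) :=
  (Measure.pi fun c : Fin C =>
    ((ProbabilityTheory.cond (mlLaw (H.MM c) (H.MD c) (H.MV c))
        (stiefelPos n p)).comap Subtype.val).prod
      (((ProbabilityTheory.cond (imdyLaw n (H.ν c) (H.η c))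
        (orderedCone p)).comap Subtype.val).prod
      (mlLaw (H.VM c) (H.VD c) (H.VV c)))).prod
  ((dirichletLaw H.α).comap Subtype.val)

/-! ### Posterior and weak neighbourhoods -/

/-- The likelihood ratio `∏_{i < N} f(X_i; ξ) / f(X_i; ξ₀)`. -/
noncomputable def likelihoodRatio {n p C : ℕ} (ξ₀ : MixParam n p C) (X : ℕ → stiefel n p)
    (N : ℕ) (ξ : MixParam n p C) : ℝ :=
  ∏ i ∈ Finset.range N, mixtureDensity ξ (X i) / mixtureDensity ξ₀ (X i)

/-- The integral over `A` of the likelihood ratio against a prior `Pr`. -/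
noncomputable def evidence {n p C : ℕ} (Pr : Measure (MixParam n p C)) (ξ₀ : MixParam n p C)
    (X : ℕ → stiefel n p) (N : ℕ) (A : Set (MixParam n p C)) : ℝ≥0∞ :=
  ∫⁻ ξ in A, ENNReal.ofReal (likelihoodRatio ξ₀ X N ξ) ∂Pr

/-- The posterior probability `Pr(A | X_1, …, X_N)` (the observations are `X 0, …, X (N - 1)`). -/
noncomputable def posterior {n p C : ℕ} (Pr : Measure (MixParam n p C)) (ξ₀ : MixParam n p C)
    (X : ℕ → stiefel n p) (N : ℕ) (A : Set (MixParam n p C)) : ℝ≥0∞ :=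
  evidence Pr ξ₀ X N A / evidence Pr ξ₀ X N Set.univ

/-- The basic weak neighbourhood of `ξ₀` given by `ε` and bounded continuous test functions `g ∈ G`:
the `ξ` with `|∫ g f_{ξ₀} [dX] - ∫ g f_ξ [dX]| < ε` for all `g ∈ G`. -/
def weakBall {n p C : ℕ} (ξ₀ : MixParam n p C) (G : Finset (stiefel n p →ᵇ ℝ)) (ε : ℝ) :
    Set (MixParam n p C) :=
  {ξ | ∀ g ∈ G, |∫ X, g X * mixtureDensity ξ₀ X ∂(stiefelHaar n p)
      - ∫ X, g X * mixtureDensity ξ X ∂(stiefelHaar n p)| < ε}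

/-- `U` is a weak neighbourhood of `ξ₀`: it contains a basic one. -/
def IsWeakNhd {n p C : ℕ} (ξ₀ : MixParam n p C) (U : Set (MixParam n p C)) : Prop :=
  ∃ (G : Finset (stiefel n p →ᵇ ℝ)) (ε : ℝ), 0 < ε ∧ weakBall ξ₀ G ε ⊆ U

/-! ### The mixture law is a probability measure -/

instance instCompactSpaceStiefel (n p : ℕ) : CompactSpace (stiefel n p) :=
  isCompact_iff_compactSpace.mp (isCompact_orthonormal n p)

lemma continuous_orbitMap {n p : ℕ} (h : p ≤ n) : Continuous (orbitMap (n := n) (p := p) h) :=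
  Continuous.subtype_mk (continuous_subtype_val.matrix_mul continuous_const) _

lemma isProbabilityMeasure_stiefelHaar {n p : ℕ} (h : p ≤ n) :
    IsProbabilityMeasure (stiefelHaar n p) := by
  rw [stiefelHaar, dif_pos h]
  exact Measure.isProbabilityMeasure_map (continuous_orbitMap h).measurable.aemeasurable

lemma le_of_mem_stiefel {n p : ℕ} {X : Matrix (Fin n) (Fin p) ℝ} (hX : X ∈ stiefel n p) :
    p ≤ n := by
  have h1 : (X.transpose * X).rank = p := by
    rw [show X.transpose * X = 1 from hX]; simp
  calc p = (X.transpose * X).rank := h1.symm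
    _ ≤ X.rank := Matrix.rank_mul_le_right _ _
    _ ≤ n := by simpa using Matrix.rank_le_height X

/-- `O(n)` acts transitively on `V_{n,p}`. -/
lemma exists_orthogonal_mul_iStar {n p : ℕ} (h : p ≤ n) {M : Matrix (Fin n) (Fin p) ℝ}
    (hM : M ∈ stiefel n p) : ∃ Q : OGroup n, Q.1 * iStar n p = M := by
  let v : Fin n → EuclideanSpace ℝ (Fin n) := fun i =>
    if hi : (i : ℕ) < p then WithLp.toLp 2 (fun k => M k ⟨i, hi⟩) else 0
  let s : Set (Fin n) := {i | (i : ℕ) < p}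
  have hv : Orthonormal ℝ (s.domRestrict v) := by
    rw [orthonormal_iff_ite]
    rintro ⟨i, hi⟩ ⟨j, hj⟩
    have hi' : (i : ℕ) < p := hi
    have hj' : (j : ℕ) < p := hj
    have e := congrFun (congrFun (show M.transpose * M = 1 from hM) ⟨i, hi'⟩) ⟨j, hj'⟩
    simp only [Matrix.mul_apply, Matrix.transpose_apply, Matrix.one_apply, Fin.mk.injEq] at e
    simp only [Set.domRestrict_apply, v, hi', hj', dif_pos, PiLp.inner_apply, Subtype.mk.injEq,
      Fin.ext_iff]
    rw [← e]
    refine Finset.sum_congr rfl fun k _ => ?_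
    simp [mul_comm]
  obtain ⟨b, hb⟩ := hv.exists_orthonormalBasis_extension_of_card_eq (by simp)
  refine ⟨⟨Matrix.of fun k i => b i k, ?_⟩, ?_⟩
  · rw [Matrix.mem_orthogonalGroup_iff']
    ext i j
    have := orthonormal_iff_ite.mp b.orthonormal i j
    rw [Matrix.one_apply, ← this]
    simp only [Matrix.mul_apply, Matrix.transpose_apply, Matrix.of_apply, PiLp.inner_apply]
    refine Finset.sum_congr rfl fun k _ => ?_
    simp [mul_comm]
  · ext k j
    have hj : (Fin.castLE h j : Fin n) ∈ s := j.2
    have hbj := hb _ hj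
    simp only [iStar, Matrix.mul_apply, Matrix.of_apply]
    rw [Finset.sum_eq_single (Fin.castLE h j)]
    · rw [hbj]
      simp [v]
    · intro i _ hi
      have : ¬ (i : ℕ) = (j : ℕ) := fun e => hi (Fin.ext (by simpa using e))
      simp [this]
    · simp

instance instIsMulRightInvariantOrthogonalHaar (n : ℕ) :
    (orthogonalHaar n).IsMulRightInvariant := by
  refine ⟨fun g => ?_⟩
  have : IsProbabilityMeasure (Measure.map (fun x => x * g) (orthogonalHaar n)) :=
    Measure.isProbabilityMeasure_map (measurable_mul_const g).aemeasurable
  exact Measure.isHaarMeasure_eq_of_isProbabilityMeasure _ _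

lemma continuous_etr {n p : ℕ} (A : Matrix (Fin p) (Fin n) ℝ) :
    Continuous fun X : stiefel n p => Real.exp (Matrix.trace (A * X.1)) :=
  Real.continuous_exp.comp (Continuous.matrix_trace
    (continuous_const.matrix_mul continuous_subtype_val))

lemma integral_stiefelHaar {n p : ℕ} (h : p ≤ n) {f : stiefel n p → ℝ} (hf : Continuous f) :
    ∫ X, f X ∂(stiefelHaar n p) = ∫ Q, f (orbitMap h Q) ∂(orthogonalHaar n) := by
  rw [stiefelHaar, dif_pos h]
  exact integral_map (continuous_orbitMap h).measurable.aemeasurable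
    hf.measurable.aestronglyMeasurable

/-- `∫ etr(V D Mᵀ X) [dX]` depends on `d` alone. -/
lemma integral_etr_eq_hyp0F1 {n p : ℕ} (M : stiefel n p) (d : Fin p → ℝ) (V : stiefel p p) :
    ∫ X : stiefel n p, Real.exp (Matrix.trace (V.1 * Matrix.diagonal d * M.1.transpose * X.1))
      ∂(stiefelHaar n p) = hyp0F1 n d := by
  have h : p ≤ n := le_of_mem_stiefel M.2
  have hIV : iStar n p * V.1 ∈ stiefel n p := by
    change (iStar n p * V.1).transpose * (iStar n p * V.1) = 1
    rw [Matrix.transpose_mul, Matrix.mul_assoc, ← Matrix.mul_assoc _ (iStar n p) V.1,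
      show (iStar n p).transpose * iStar n p = 1 from iStar_mem h, Matrix.one_mul]
    exact V.2
  obtain ⟨R, hR⟩ := exists_orthogonal_mul_iStar h M.2
  obtain ⟨P, hP⟩ := exists_orthogonal_mul_iStar h hIV
  rw [hyp0F1, integral_stiefelHaar h (continuous_etr _), integral_stiefelHaar h (continuous_etr _)]
  have hinv : (R⁻¹ : OGroup n).1 = R.1.transpose := rfl
  set G : OGroup n → ℝ := fun Q => Real.exp (Matrix.trace
    (Matrix.diagonal d * (iStar n p).transpose * (orbitMap h Q).1)) with hG
  calc _ = ∫ Q, G (R⁻¹ * Q * P) ∂(orthogonalHaar n) := by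
        refine integral_congr_ae (ae_of_all _ fun Q => ?_)
        have key : (R⁻¹ * Q * P : OGroup n).1 * iStar n p
            = R.1.transpose * Q.1 * (iStar n p * V.1) := by
          rw [← hP, ← hinv, ← Matrix.mul_assoc]; rfl
        simp only [hG, orbitMap, key]
        rw [← hR, Matrix.transpose_mul]
        congr 1
        simp only [Matrix.mul_assoc]
        rw [Matrix.trace_mul_comm]
        simp only [Matrix.mul_assoc]
    _ = ∫ Q, G (R⁻¹ * Q) ∂(orthogonalHaar n) := by
        exact integral_mul_right_eq_self (μ := orthogonalHaar n) (fun Q => G (R⁻¹ * Q)) P |>.symm ▸ by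
          simp only [mul_assoc]
    _ = _ := integral_mul_left_eq_self G R⁻¹

lemma hyp0F1_pos {n p : ℕ} (h : p ≤ n) (d : Fin p → ℝ) : 0 < hyp0F1 n d := by
  have := isProbabilityMeasure_stiefelHaar h
  refine integral_exp_pos ?_
  exact (BoundedContinuousFunction.mkOfCompact ⟨_, continuous_etr _⟩).integrable _

lemma mlDensity_pos {n p : ℕ} (M : stiefel n p) (d : Fin p → ℝ) (V : stiefel p p)
    (X : stiefel n p) : 0 < mlDensity M d V X :=
  div_pos (Real.exp_pos _) (hyp0F1_pos (le_of_mem_stiefel M.2) d)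

lemma continuous_mlDensity {n p : ℕ} (M : stiefel n p) (d : Fin p → ℝ) (V : stiefel p p) :
    Continuous (mlDensity M d V) :=
  (continuous_etr _).div_const _

lemma integrable_mlDensity {n p : ℕ} (M : stiefel n p) (d : Fin p → ℝ) (V : stiefel p p) :
    Integrable (mlDensity M d V) (stiefelHaar n p) := by
  have := isProbabilityMeasure_stiefelHaar (le_of_mem_stiefel M.2)
  exact (BoundedContinuousFunction.mkOfCompact ⟨_, continuous_mlDensity M d V⟩).integrable _

lemma integral_mlDensity {n p : ℕ} (M : stiefel n p) (d : Fin p → ℝ) (V : stiefel p p) :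
    ∫ X, mlDensity M d V X ∂(stiefelHaar n p) = 1 := by
  simp only [mlDensity]
  rw [integral_div, integral_etr_eq_hyp0F1]
  exact div_self (hyp0F1_pos (le_of_mem_stiefel M.2) d).ne'

instance instIsProbMlLaw {n p : ℕ} (M : stiefel n p) (d : Fin p → ℝ) (V : stiefel p p) :
    IsProbabilityMeasure (mlLaw M d V) := by
  refine ⟨?_⟩
  rw [mlLaw, withDensity_apply _ MeasurableSet.univ, Measure.restrict_univ,
    ← ofReal_integral_eq_lintegral_ofReal (integrable_mlDensity M d V)
      (ae_of_all _ fun X => (mlDensity_pos M d V X).le), integral_mlDensity, ENNReal.ofReal_one]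

instance instIsProbMixtureLaw {n p C : ℕ} (ξ : MixParam n p C) :
    IsProbabilityMeasure (mixtureLaw ξ) := by
  refine ⟨?_⟩
  have hint : ∀ c ∈ (Finset.univ : Finset (Fin C)), Integrable
      (fun X => ξ.2.1 c * mlDensity (ξ.1 c).1.1 (ξ.1 c).2.1.1 (ξ.1 c).2.2 X) (stiefelHaar n p) :=
    fun c _ => (integrable_mlDensity _ _ _).const_mul _
  rw [mixtureLaw, withDensity_apply _ MeasurableSet.univ, Measure.restrict_univ,
    ← ofReal_integral_eq_lintegral_ofReal]
  · simp only [mixtureDensity]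
    rw [integral_finsetSum _ hint]
    simp only [integral_const_mul, integral_mlDensity, mul_one]
    rw [ξ.2.2.2, ENNReal.ofReal_one]
  · exact integrable_finsetSum _ hint
  · exact ae_of_all _ fun X => Finset.sum_nonneg fun c _ =>
      mul_nonneg (ξ.2.2.1 c).le (mlDensity_pos _ _ _ X).le

end MatrixLangevin

namespace MatrixLangevin

/-! ### Conditioning to a set of positive mass -/

/-! The argument is Schwartz's, with exponential bounds made explicit by the compactness of the
Stiefel manifold.

Denominator: the mixture density is jointly continuous and positive and the sample space is compact,
so for each `q < 1` there is an open neighbourhood `B` of `ξ₀` on which `q * f_{ξ₀} < f_ξ` at every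
point of the manifold. The likelihood ratio is therefore at least `q ^ N` on `B`, for every data
sequence, and the evidence is at least `Π(B) * q ^ N` (`exists_mul_pow_le_evidence`). No
Kullback–Leibler estimate or law of large numbers is needed, only `Π(B) > 0`.

Numerator: the complement of a weak neighbourhood is covered by finitely many sets `upperHalf ξ₀ g
ε`. On such a set the statistic `Y = m + ε/2 - g`, with `m` the mean of `g` under `ξ₀`, has mean at
most `-ε/2`, while under `ξ₀` its mean is `ε/2`. For small `t` both `E_ξ exp(tY)` and `E_{ξ₀}
exp(-tY)` are at most some `ρ < 1`. Fubini turns the first bound into a bound `ρ ^ N` for the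
expectation of the numerator weighted by `∏ exp(t Y(X_i))`; Markov and Borel–Cantelli, applied to
this and to the inverse weight, make the numerator exponentially small almost surely
(`ae_evidence_upperHalf_lt`). Taking `q` close enough to 1, the quotient tends to 0.

It remains that the prior is a probability measure charging every nonempty open set
(`isProbabilityMeasure_and_isOpenPos_prior`). Positivity of the densities gives the support; the
real content is that the IMDY and Dirichlet normalizing integrals are finite. -/

lemma isProbabilityMeasure_comap_cond {α : Type*} [MeasurableSpace α] (μ : Measure α)
    {s : Set α} (hs : MeasurableSet s) (h0 : μ s ≠ 0) (h1 : μ s ≠ ∞) :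
    IsProbabilityMeasure ((ProbabilityTheory.cond μ s).comap (Subtype.val : s → α)) := by
  refine ⟨?_⟩
  rw [comap_subtype_coe_apply hs, Set.image_univ, Subtype.range_coe, cond_apply hs,
    Set.inter_self, ENNReal.inv_mul_cancel h0 h1]

/-- The hypothesis concerns `s ∩ U` because `s` need not be open: the simplex is not open in its
ambient space. Finiteness of `μ s` keeps the normalizing factor `(μ s)⁻¹` from vanishing. -/
lemma isOpenPosMeasure_comap_cond {α : Type*} [TopologicalSpace α] [MeasurableSpace α]
    (μ : Measure α) {s : Set α} (hs : MeasurableSet s) (h1 : μ s ≠ ∞)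
    (h : ∀ U : Set α, IsOpen U → (s ∩ U).Nonempty → μ (s ∩ U) ≠ 0) :
    ((ProbabilityTheory.cond μ s).comap (Subtype.val : s → α)).IsOpenPosMeasure := by
  refine ⟨fun V hV ⟨x, hx⟩ => ?_⟩
  obtain ⟨U, hU, rfl⟩ := isOpen_induced_iff.mp hV
  rw [comap_subtype_coe_apply hs, Subtype.image_preimage_coe, cond_apply hs,
    ← Set.inter_assoc, Set.inter_self]
  exact mul_ne_zero (ENNReal.inv_ne_zero.mpr h1) (h U hU ⟨x, x.2, hx⟩)

lemma isOpenPosMeasure_withDensity {α : Type*} [TopologicalSpace α] [MeasurableSpace α]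
    (μ : Measure α) [μ.IsOpenPosMeasure] {f : α → ℝ} (hf : Measurable f) (hpos : ∀ x, 0 < f x) :
    (μ.withDensity fun x => ENNReal.ofReal (f x)).IsOpenPosMeasure :=
  (withDensity_absolutelyContinuous' (μ := μ) hf.ennreal_ofReal.aemeasurable
    (ae_of_all _ fun x => (ENNReal.ofReal_pos.mpr (hpos x)).ne')).isOpenPosMeasure

/-! ### The matrix Langevin distributions have full support -/

lemma orbitMap_surjective {n p : ℕ} (h : p ≤ n) :
    Function.Surjective (orbitMap (n := n) (p := p) h) := fun M => by
  obtain ⟨Q, hQ⟩ := exists_orthogonal_mul_iStar h M.2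
  exact ⟨Q, Subtype.ext hQ⟩

lemma isOpenPosMeasure_stiefelHaar {n p : ℕ} (h : p ≤ n) :
    (stiefelHaar n p).IsOpenPosMeasure := by
  rw [stiefelHaar, dif_pos h]
  exact (continuous_orbitMap h).isOpenPosMeasure_map (orbitMap_surjective h)

instance instIsOpenPosMlLaw {n p : ℕ} (M : stiefel n p) (d : Fin p → ℝ) (V : stiefel p p) :
    (mlLaw M d V).IsOpenPosMeasure := by
  have := isOpenPosMeasure_stiefelHaar (le_of_mem_stiefel M.2)
  exact isOpenPosMeasure_withDensity _ (continuous_mlDensity M d V).measurable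
    (mlDensity_pos M d V)

lemma isOpen_stiefelPos (n p : ℕ) : IsOpen (stiefelPos n p) := by
  simp only [stiefelPos, Set.ofPred_forall]
  refine isOpen_iInter_of_finite fun i => isOpen_iInter_of_finite fun _ =>
    isOpen_iInter_of_finite fun j => isOpen_lt continuous_const ?_
  exact (continuous_subtype_val (p := (· ∈ stiefel n p))).matrix_elem i j

/-! ### The normalizing constant -/

instance instSecondCountableMat (n p : ℕ) :
    SecondCountableTopology (Matrix (Fin n) (Fin p) ℝ) :=
  inferInstanceAs (SecondCountableTopology (Fin n → Fin p → ℝ))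

lemma continuous_hyp0F1 {n p : ℕ} (h : p ≤ n) :
    Continuous (hyp0F1 n : (Fin p → ℝ) → ℝ) := by
  have := isProbabilityMeasure_stiefelHaar h
  have hc : Continuous (Function.uncurry fun (d : Fin p → ℝ) (X : stiefel n p) =>
      Real.exp (Matrix.trace (Matrix.diagonal d * (iStar n p).transpose * X.1))) := by
    refine Real.continuous_exp.comp (Continuous.matrix_trace ?_)
    exact ((continuous_fst.matrix_diagonal).matrix_mul continuous_const).matrix_mul
      (continuous_subtype_val.comp continuous_snd)
  have := continuous_parametric_integral_of_continuous (μ := stiefelHaar n p) hc isCompact_univ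
  simp only [Measure.restrict_univ] at this
  exact this

lemma trace_diagonal_iStar {n p : ℕ} (h : p ≤ n) (d : Fin p → ℝ)
    (X : Matrix (Fin n) (Fin p) ℝ) :
    Matrix.trace (Matrix.diagonal d * (iStar n p).transpose * X)
      = ∑ j, d j * X (Fin.castLE h j) j := by
  simp only [Matrix.trace, Matrix.diag_apply, Matrix.mul_assoc, Matrix.diagonal_mul]
  refine Finset.sum_congr rfl fun j _ => ?_
  rw [Matrix.mul_apply, Finset.sum_eq_single (Fin.castLE h j)]
  · simp [iStar]
  · intro i _ hi
    have : ¬ (i : ℕ) = (j : ℕ) := fun e => hi (Fin.ext (by simpa using e))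
    simp [iStar, this]
  · simp

/-- On the positive orthant `₀F₁(n/2, D²/4)` grows at least like `exp (a ∑ d_j)`, for any `a < 1`. -/
lemma exists_mul_exp_le_hyp0F1 {n p : ℕ} (h : p ≤ n) {a : ℝ} (ha : a < 1) :
    ∃ c : ℝ, 0 < c ∧ ∀ d : Fin p → ℝ, (∀ j, 0 < d j) →
      c * Real.exp (a * ∑ j, d j) ≤ hyp0F1 n d := by
  have := isProbabilityMeasure_stiefelHaar h
  have := isOpenPosMeasure_stiefelHaar h
  -- The exponent is `∑ d_j X_jj`, which exceeds `a ∑ d_j` wherever all `X_jj > a`. This set is open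
  -- and contains `I⋆` because `a < 1`, so it has positive mass, and that mass serves as `c`.
  set O : Set (stiefel n p) := {X | ∀ j, a < X.1 (Fin.castLE h j) j} with hO
  have hOo : IsOpen O := by
    simp only [hO, Set.ofPred_forall]
    refine isOpen_iInter_of_finite fun j => isOpen_lt continuous_const ?_
    exact (continuous_subtype_val (p := (· ∈ stiefel n p))).matrix_elem _ _
  have hOn : O.Nonempty := ⟨⟨iStar n p, iStar_mem h⟩, fun j => by simpa [iStar] using ha⟩
  refine ⟨(stiefelHaar n p).real O, ?_, fun d hd => ?_⟩
  · exact ENNReal.toReal_pos (hOo.measure_ne_zero _ hOn) (measure_ne_top _ _)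
  have hint : Integrable (fun X : stiefel n p =>
      Real.exp (Matrix.trace (Matrix.diagonal d * (iStar n p).transpose * X.1)))
      (stiefelHaar n p) :=
    (BoundedContinuousFunction.mkOfCompact ⟨_, continuous_etr _⟩).integrable _
  calc _ = ∫ _ in O, Real.exp (a * ∑ j, d j) ∂(stiefelHaar n p) := by
        rw [setIntegral_const, smul_eq_mul]
    _ ≤ ∫ X in O, Real.exp (Matrix.trace (Matrix.diagonal d * (iStar n p).transpose * X.1))
          ∂(stiefelHaar n p) := by
        refine setIntegral_mono_on (integrableOn_const (measure_ne_top _ _)) hint.integrableOn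
          hOo.measurableSet fun X hX => ?_
        rw [trace_diagonal_iStar h, Finset.mul_sum]
        refine Real.exp_le_exp.mpr (Finset.sum_le_sum fun j _ => ?_)
        rw [mul_comm]
        exact mul_le_mul_of_nonneg_left (hX j).le (hd j).le
    _ ≤ _ := setIntegral_le_integral hint (ae_of_all _ fun X => (Real.exp_pos _).le)

/-! ### The IMDY distribution -/

lemma setLIntegral_pi_prod_lt_top {ι : Type*} [Fintype ι] {f : ι → ℝ → ℝ} {s : ι → Set ℝ}
    (hf : ∀ i, IntegrableOn (f i) (s i)) :
    ∫⁻ x in Set.univ.pi s, ENNReal.ofReal (∏ i, f i (x i)) < ∞ := by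
  rw [volume_pi, Measure.restrict_pi_pi]
  exact (Integrable.fintype_prod hf).lintegral_lt_top

/-- The unnormalized `IMDY` measure. -/
noncomputable def imdyBase (n : ℕ) {p : ℕ} (ν : ℝ) (η : Fin p → ℝ) : Measure (Fin p → ℝ) :=
  (volume : Measure (Fin p → ℝ)).withDensity fun d =>
    ENNReal.ofReal (Real.exp (ν * ∑ j, η j * d j) / hyp0F1 n d ^ ν)

lemma isOpenPosMeasure_imdyBase {n p : ℕ} (h : p ≤ n) (ν : ℝ) (η : Fin p → ℝ) :
    (imdyBase n ν η).IsOpenPosMeasure := by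
  refine isOpenPosMeasure_withDensity _ ?_ fun d =>
    div_pos (Real.exp_pos _) (Real.rpow_pos_of_pos (hyp0F1_pos h d) _)
  have := (continuous_hyp0F1 (p := p) h).measurable
  fun_prop

lemma isOpen_orthant (p : ℕ) : IsOpen {d : Fin p → ℝ | ∀ j, 0 < d j} := by
  simp only [Set.ofPred_forall]
  exact isOpen_iInter_of_finite fun j => isOpen_lt continuous_const (continuous_apply j)

/-- With `a` strictly between all `η j` and 1, the lower bound for the normalizing constant
dominates the density by a multiple of `∏ exp(-ν (a - η_j) d_j)`, a product of integrable
exponentials. -/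
lemma imdyBase_orthant_lt_top {n p : ℕ} (h : p ≤ n) {ν : ℝ} (hν : 0 < ν) {η : Fin p → ℝ}
    (hη : ∀ j, η j < 1) : imdyBase n ν η {d | ∀ j, 0 < d j} < ∞ := by
  obtain ⟨a, ha, hηa⟩ : ∃ a < 1, ∀ j, η j < a := by
    rcases isEmpty_or_nonempty (Fin p) with hE | hE
    · exact ⟨0, one_pos, fun j => hE.elim j⟩
    · obtain ⟨k, hk⟩ := Finite.exists_max η
      obtain ⟨a, h1, h2⟩ := exists_between (hη k)
      exact ⟨a, h2, fun j => (hk j).trans_lt h1⟩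
  obtain ⟨c, hc, hle⟩ := exists_mul_exp_le_hyp0F1 (n := n) (p := p) h ha
  have hset : {d : Fin p → ℝ | ∀ j, 0 < d j} = Set.univ.pi fun _ => Set.Ioi 0 := by
    ext d; simp
  rw [imdyBase, withDensity_apply _ (isOpen_orthant p).measurableSet]
  calc _ ≤ ∫⁻ d in {d : Fin p → ℝ | ∀ j, 0 < d j}, ENNReal.ofReal (c ^ ν)⁻¹ *
        ENNReal.ofReal (∏ j, Real.exp (-(ν * (a - η j)) * d j)) := by
        refine setLIntegral_mono' (isOpen_orthant p).measurableSet fun d hd => ?_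
        rw [← ENNReal.ofReal_mul (by positivity)]
        refine ENNReal.ofReal_le_ofReal ?_
        have h1 : c ^ ν * Real.exp (ν * (a * ∑ j, d j)) ≤ hyp0F1 n d ^ ν := by
          rw [mul_comm ν, Real.exp_mul, ← Real.mul_rpow hc.le (Real.exp_pos _).le]
          exact Real.rpow_le_rpow (by positivity) (hle d hd) hν.le
        calc _ ≤ Real.exp (ν * ∑ j, η j * d j) / (c ^ ν * Real.exp (ν * (a * ∑ j, d j))) :=
              div_le_div_of_nonneg_left (Real.exp_pos _).le (by positivity) h1
          _ = _ := by
              rw [← Real.exp_sum, div_mul_eq_div_div_swap, ← Real.exp_sub, div_eq_inv_mul]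
              congr 2
              simp only [Finset.mul_sum, ← Finset.sum_sub_distrib]
              exact Finset.sum_congr rfl fun j _ => by ring
    _ = ENNReal.ofReal (c ^ ν)⁻¹ * ∫⁻ d in {d : Fin p → ℝ | ∀ j, 0 < d j},
        ENNReal.ofReal (∏ j, Real.exp (-(ν * (a - η j)) * d j)) :=
        lintegral_const_mul' _ _ ENNReal.ofReal_ne_top
    _ < ∞ := by
        refine ENNReal.mul_lt_top ENNReal.ofReal_lt_top ?_
        rw [hset]
        exact setLIntegral_pi_prod_lt_top (f := fun j x => Real.exp (-(ν * (a - η j)) * x))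
          fun j => integrableOn_exp_mul_Ioi (by nlinarith [hηa j]) 0

lemma isOpen_orderedCone (p : ℕ) : IsOpen (orderedCone p) := by
  have : orderedCone p = {d | ∀ j, 0 < d j} ∩ ⋂ i, ⋂ j, ⋂ _ : i < j, {d | d j < d i} := by
    ext d; simp [orderedCone, StrictAnti]
  rw [this]
  exact (isOpen_orthant p).inter (isOpen_iInter_of_finite fun i => isOpen_iInter_of_finite
    fun j => isOpen_iInter_of_finite fun _ => isOpen_lt (continuous_apply j) (continuous_apply i))

lemma imdyLaw_inter_ne_zero {n p : ℕ} (h : p ≤ n) {ν : ℝ} (hν : 0 < ν) {η : Fin p → ℝ}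
    (hη : ∀ j, η j < 1) {U : Set (Fin p → ℝ)} (hU : IsOpen U)
    (hne : (orderedCone p ∩ U).Nonempty) : imdyLaw n ν η (orderedCone p ∩ U) ≠ 0 := by
  have := isOpenPosMeasure_imdyBase h ν η
  have hsub : orderedCone p ∩ U ⊆ {d | ∀ j, 0 < d j} := fun d hd => hd.1.1
  rw [imdyLaw, cond_apply (isOpen_orthant p).measurableSet, Set.inter_eq_right.mpr hsub]
  exact mul_ne_zero (ENNReal.inv_ne_zero.mpr (imdyBase_orthant_lt_top h hν hη).ne)
    (((isOpen_orderedCone p).inter hU).measure_ne_zero (imdyBase n ν η) hne)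

instance instIsFiniteImdyLaw {n p : ℕ} (ν : ℝ) (η : Fin p → ℝ) :
    IsFiniteMeasure (imdyLaw n ν η) := by
  unfold imdyLaw; infer_instance

/-! ### The Dirichlet distribution -/

section Dirichlet

variable {C : ℕ} [NeZero C]

lemma continuous_simplexChart : Continuous (simplexChart C) := by
  refine continuous_pi fun c => ?_
  unfold simplexChart
  split_ifs <;> fun_prop

lemma sum_simplexChart (x : {c : Fin C // c ≠ 0} → ℝ) : ∑ c, simplexChart C x c = 1 := by
  have hs : ∑ c ∈ Finset.univ.erase 0, simplexChart C x c
      = ∑ c : {c : Fin C // c ≠ 0}, simplexChart C x c := Finset.sum_subtype _ (by simp) _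
  rw [← Finset.add_sum_erase _ _ (Finset.mem_univ 0), hs]
  simp only [simplexChart, dite_true]
  have e : ∀ c : {c : Fin C // c ≠ 0}, (if h : (c : Fin C) = 0 then 1 - ∑ b, x b else x ⟨c, h⟩)
      = x c := fun c => dif_neg c.2
  simp [e]

lemma simplexChart_eq {w : Fin C → ℝ} (hw : ∑ c, w c = 1) :
    simplexChart C (fun c => w c) = w := by
  rw [← Finset.add_sum_erase _ _ (Finset.mem_univ 0),
    Finset.sum_subtype (p := fun c : Fin C => c ≠ 0) _ (by simp)] at hw
  ext c
  by_cases hc : c = 0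
  · subst hc; simp only [simplexChart, dite_true]; linarith
  · simp [simplexChart, hc]

omit [NeZero C] in
lemma measurableSet_openSimplex : MeasurableSet (openSimplex C) := by
  unfold openSimplex
  measurability

/-- Lebesgue measure on `{w | ∑ w = 1}`. -/
noncomputable def simplexVolume (C : ℕ) [NeZero C] : Measure (Fin C → ℝ) :=
  (volume : Measure ({c : Fin C // c ≠ 0} → ℝ)).map (simplexChart C)

/-- The linear involution that replaces the coordinate `k` by minus the sum of all coordinates. -/
noncomputable def negSumAt {ι : Type*} [Fintype ι] [DecidableEq ι] (k : ι) :
    (ι → ℝ) →ₗ[ℝ] ι → ℝ where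
  toFun x := Function.update x k (-∑ b, x b)
  map_add' x y := by
    ext b
    by_cases hb : b = k
    · subst hb; simp [Finset.sum_add_distrib]; ring
    · simp [hb]
  map_smul' r x := by
    ext b
    by_cases hb : b = k
    · subst hb; simp [Finset.mul_sum]
    · simp [hb]

lemma negSumAt_comp_self {ι : Type*} [Fintype ι] [DecidableEq ι] (k : ι) :
    negSumAt k ∘ₗ negSumAt k = LinearMap.id := by
  refine LinearMap.ext fun v => funext fun b => ?_
  simp only [LinearMap.comp_apply, LinearMap.id_apply]
  by_cases hb : b = k
  · subst hb
    simp only [negSumAt, LinearMap.coe_mk, AddHom.coe_mk, Function.update_self,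
      Finset.sum_update_of_mem (Finset.mem_univ _)]
    rw [← Finset.add_sum_erase _ v (Finset.mem_univ b), Finset.sdiff_singleton_eq_erase]
    ring
  · simp [negSumAt, hb]

/-- An involution has determinant `±1`. -/
lemma measurePreserving_negSumAt {ι : Type*} [Fintype ι] [DecidableEq ι] (k : ι) :
    MeasurePreserving (negSumAt k) (volume : Measure (ι → ℝ)) volume := by
  have h1 : LinearMap.det (negSumAt k) * LinearMap.det (negSumAt k) = 1 := by
    rw [← LinearMap.det_comp, negSumAt_comp_self, LinearMap.det_id]
  have h2 : |(LinearMap.det (negSumAt k))⁻¹| = 1 := by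
    rcases mul_self_eq_one_iff.mp h1 with h | h <;> simp [h]
  refine ⟨(LinearMap.continuous_of_finiteDimensional _).measurable, ?_⟩
  rw [Real.map_linearMap_volume_pi_eq_smul_volume_pi (left_ne_zero_of_mul_eq_one h1), h2]
  simp

/-- Lebesgue measure on `{w | ∑ w = 1}` does not depend on the coordinate left out in its chart. -/
lemma simplexVolume_map_swap (k : Fin C) :
    (simplexVolume C).map (fun w => w ∘ Equiv.swap 0 k) = simplexVolume C := by
  by_cases hk : k = 0
  · subst hk; simp only [Equiv.swap_self, Equiv.coe_refl, Function.comp_id]; exact Measure.map_id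
  set k' : {c : Fin C // c ≠ 0} := ⟨k, hk⟩
  -- In the chart, exchanging the weights `0` and `k` replaces `x_k` by `1 - ∑ x`: the involution
  -- `negSumAt` followed by translation by the `k`-th basis vector.
  have hT : MeasurePreserving (fun x => Pi.single k' (1 : ℝ) + negSumAt k' x) volume volume :=
    (measurePreserving_add_left volume _).comp (measurePreserving_negSumAt k')
  have hTx : ∀ x, Pi.single k' (1 : ℝ) + negSumAt k' x = Function.update x k' (1 - ∑ b, x b) := by
    intro x
    ext b
    by_cases hb : b = k'
    · subst hb; simp [negSumAt, sub_eq_add_neg]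
    · simp [negSumAt, hb]
  have hcomp : (fun w : Fin C → ℝ => w ∘ Equiv.swap 0 k) ∘ simplexChart C
      = simplexChart C ∘ fun x => Pi.single k' (1 : ℝ) + negSumAt k' x := by
    ext x c
    simp only [Function.comp_apply, hTx]
    by_cases hc0 : c = 0
    · subst hc0
      simp only [Equiv.swap_apply_left, simplexChart, dite_true, hk, dite_false,
        Finset.sum_update_of_mem (Finset.mem_univ _)]
      rw [← Finset.add_sum_erase _ x (Finset.mem_univ k'), Finset.sdiff_singleton_eq_erase]
      ring
    · by_cases hck : c = k
      · subst hck; simp [simplexChart, hk, k']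
      · have hne : (⟨c, hc0⟩ : {c : Fin C // c ≠ 0}) ≠ k' := fun e => hck (congrArg Subtype.val e)
        rw [Equiv.swap_apply_of_ne_of_ne hc0 hck]
        simp [simplexChart, hc0, hne]
  have hm : Measurable (simplexChart C) := continuous_simplexChart.measurable
  rw [simplexVolume, Measure.map_map (by fun_prop) hm, hcomp, ← Measure.map_map hm hT.measurable,
    hT.map_eq]

/-- The part of the open simplex where the weight `k` is at least `1 / C`. -/
def simplexPiece (k : Fin C) : Set (Fin C → ℝ) := openSimplex C ∩ {w | 1 / (C : ℝ) ≤ w k}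

/-- Some weight is at least the average `1 / C`. -/
lemma openSimplex_subset_iUnion : openSimplex C ⊆ ⋃ k, simplexPiece k := by
  intro w hw
  by_contra hcon
  simp only [simplexPiece, Set.mem_iUnion, Set.mem_inter_iff, hw, true_and, not_exists,
    Set.mem_ofPred_eq, not_le] at hcon
  have hlt : ∑ c, w c < ∑ _c : Fin C, 1 / (C : ℝ) :=
    Finset.sum_lt_sum_of_nonempty Finset.univ_nonempty fun c _ => hcon c
  have hC : (C : ℝ) ≠ 0 := NeZero.ne _
  rw [hw.2] at hlt
  simp [hC] at hlt

omit [NeZero C] in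
lemma measurableSet_simplexPiece (k : Fin C) : MeasurableSet (simplexPiece k) :=
  measurableSet_openSimplex.inter (measurableSet_le measurable_const (measurable_pi_apply k))

omit [NeZero C] in
lemma le_one_of_mem_openSimplex {w : Fin C → ℝ} (hw : w ∈ openSimplex C) (c : Fin C) : w c ≤ 1 :=
  hw.2 ▸ Finset.single_le_sum (fun b _ => (hw.1 b).le) (Finset.mem_univ c)

/-- A bound uniform in the sign of `s`, for the Dirichlet factor of the weight that stays away from
0. -/
lemma rpow_le_one_add_rpow {a x s : ℝ} (ha : 0 < a) (hax : a ≤ x) (hx : x ≤ 1) :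
    x ^ s ≤ 1 + a ^ s := by
  rcases le_total 0 s with hs | hs
  · have := Real.rpow_le_one (ha.le.trans hax) hx hs
    have := Real.rpow_pos_of_pos ha s
    linarith
  · have := Real.rpow_le_rpow_of_nonpos ha hax hs
    linarith

/-- The weight left out of the chart is at least `1 / C` here, so its factor is bounded. The other
weights are the chart coordinates, confined to `(0, 1]`, where each `x ^ (α - 1)` is integrable
since `α > 0`. -/
lemma lintegral_simplexPiece_zero_lt_top {α : Fin C → ℝ} (hα : ∀ c, 0 < α c) :
    ∫⁻ w in simplexPiece 0, ENNReal.ofReal (∏ c, w c ^ (α c - 1)) ∂(simplexVolume C) < ∞ := by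
  have hC : (0 : ℝ) < 1 / C := by have : (0 : ℝ) < C := Nat.cast_pos.mpr (NeZero.pos C)
                                  positivity
  set K : ℝ := 1 + (1 / (C : ℝ)) ^ (α 0 - 1)
  have hK : 0 ≤ K := by positivity
  rw [simplexVolume, setLIntegral_map (measurableSet_simplexPiece 0) (by fun_prop)
    continuous_simplexChart.measurable]
  have hmp : MeasurableSet (simplexChart C ⁻¹' simplexPiece 0) :=
    continuous_simplexChart.measurable (measurableSet_simplexPiece 0)
  calc _ ≤ ∫⁻ x in simplexChart C ⁻¹' simplexPiece 0, ENNReal.ofReal K *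
        ENNReal.ofReal (∏ b : {c : Fin C // c ≠ 0}, x b ^ (α b - 1)) := by
        refine setLIntegral_mono' hmp fun x hx => ?_
        rw [← ENNReal.ofReal_mul hK]
        refine ENNReal.ofReal_le_ofReal ?_
        have hpos : ∀ b : {c : Fin C // c ≠ 0}, 0 < x b := fun b => by
          have := hx.1.1 b
          simpa [simplexChart, b.2] using this
        rw [← Finset.mul_prod_erase _ _ (Finset.mem_univ 0),
          Finset.prod_subtype (p := fun c : Fin C => c ≠ 0) _ (by simp)]
        have e : ∏ b : {c : Fin C // c ≠ 0}, simplexChart C x b ^ (α b - 1)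
            = ∏ b : {c : Fin C // c ≠ 0}, x b ^ (α b - 1) :=
          Finset.prod_congr rfl fun b _ => by simp [simplexChart, b.2]
        rw [e]
        exact mul_le_mul_of_nonneg_right
          (rpow_le_one_add_rpow hC hx.2 (le_one_of_mem_openSimplex hx.1 0))
          (Finset.prod_nonneg fun b _ => (Real.rpow_pos_of_pos (hpos b) _).le)
    _ ≤ ∫⁻ x in Set.univ.pi fun _ => Set.Ioc (0 : ℝ) 1, ENNReal.ofReal K *
        ENNReal.ofReal (∏ b : {c : Fin C // c ≠ 0}, x b ^ (α b - 1)) := by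
        refine lintegral_mono_set fun x hx b _ => ?_
        have h1 := hx.1.1 b
        have h2 := le_one_of_mem_openSimplex hx.1 b
        simp only [simplexChart, b.2, dite_false] at h1 h2
        exact ⟨h1, h2⟩
    _ < ∞ := by
        rw [lintegral_const_mul' _ _ ENNReal.ofReal_ne_top]
        refine ENNReal.mul_lt_top ENNReal.ofReal_lt_top
          (setLIntegral_pi_prod_lt_top
            (f := fun (b : {c : Fin C // c ≠ 0}) (x : ℝ) => x ^ (α b - 1)) fun b => ?_)
        rw [← intervalIntegrable_iff_integrableOn_Ioc_of_le zero_le_one]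
        exact intervalIntegral.intervalIntegrable_rpow' (by linarith [hα b])

/-- The unnormalized Dirichlet measure. -/
noncomputable def dirichletBase (α : Fin C → ℝ) : Measure (Fin C → ℝ) :=
  (simplexVolume C).withDensity fun w => ENNReal.ofReal (∏ c, w c ^ (α c - 1))

/-- Symmetry of `simplexVolume` under swapping weights reduces every piece to piece `0`, at the
price of permuting `α`. -/
lemma dirichletBase_simplexPiece (α : Fin C → ℝ) (k : Fin C) :
    dirichletBase α (simplexPiece k)
      = ∫⁻ w in simplexPiece 0, ENNReal.ofReal (∏ c, w c ^ (α (Equiv.swap 0 k c) - 1))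
        ∂(simplexVolume C) := by
  have hpre : (fun w : Fin C → ℝ => w ∘ Equiv.swap 0 k) ⁻¹' simplexPiece k = simplexPiece 0 := by
    ext w
    simp only [simplexPiece, openSimplex, Set.mem_preimage, Set.mem_inter_iff, Set.mem_ofPred_eq,
      Function.comp_apply, Equiv.swap_apply_right, Equiv.sum_comp (Equiv.swap 0 k) w]
    rw [Equiv.forall_congr_left (Equiv.swap 0 k)]
    simp
  rw [dirichletBase, withDensity_apply _ (measurableSet_simplexPiece k),
    ← simplexVolume_map_swap k,
    setLIntegral_map (measurableSet_simplexPiece k) (by fun_prop) (by fun_prop), hpre,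
    simplexVolume_map_swap]
  refine lintegral_congr fun w => ?_
  congr 1
  rw [← Equiv.prod_comp (Equiv.swap 0 k)]
  simp

lemma dirichletBase_openSimplex_lt_top {α : Fin C → ℝ} (hα : ∀ c, 0 < α c) :
    dirichletBase α (openSimplex C) < ∞ := by
  refine (measure_mono openSimplex_subset_iUnion).trans_lt ((measure_iUnion_le _).trans_lt ?_)
  rw [tsum_fintype]
  refine ENNReal.sum_lt_top.mpr fun k _ => ?_
  rw [dirichletBase_simplexPiece]
  exact lintegral_simplexPiece_zero_lt_top fun c => hα _

/-- The chart always lands in `∑ w = 1`, so only the open positivity conditions remain after pulling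
back: the preimage of a relatively open set is open. -/
lemma dirichletBase_inter_ne_zero (α : Fin C → ℝ) {U : Set (Fin C → ℝ)} (hU : IsOpen U)
    (hne : (openSimplex C ∩ U).Nonempty) : dirichletBase α (openSimplex C ∩ U) ≠ 0 := by
  have hmeas : MeasurableSet (openSimplex C ∩ U) := measurableSet_openSimplex.inter hU.measurableSet
  have hpre : simplexChart C ⁻¹' (openSimplex C ∩ U)
      = simplexChart C ⁻¹' ({w | ∀ c, 0 < w c} ∩ U) := by
    ext x; simp [openSimplex, sum_simplexChart]
  obtain ⟨w, hw, hwU⟩ := hne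
  rw [dirichletBase, withDensity_apply _ hmeas, ← pos_iff_ne_zero,
    setLIntegral_pos_iff (by fun_prop), simplexVolume,
    Measure.map_apply continuous_simplexChart.measurable ((by measurability :
      MeasurableSet (Function.support fun w : Fin C → ℝ =>
        ENNReal.ofReal (∏ c, w c ^ (α c - 1)))).inter hmeas)]
  have hopen : IsOpen (simplexChart C ⁻¹' (openSimplex C ∩ U)) := by
    rw [hpre]
    exact ((isOpen_orthant C).inter hU).preimage continuous_simplexChart
  refine (hopen.measure_pos volume ⟨fun c => w c, ?_⟩).trans_le (measure_mono ?_)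
  · rw [Set.mem_preimage, simplexChart_eq hw.2]; exact ⟨hw, hwU⟩
  · intro x hx
    refine ⟨?_, hx⟩
    exact (ENNReal.ofReal_pos.mpr
      (Finset.prod_pos fun c _ => Real.rpow_pos_of_pos (hx.1.1 c) _)).ne'

end Dirichlet

/-! ### The prior -/

section Prior

variable {n p C : ℕ} [NeZero C]

/-- The point `ξ₀` witnesses that the three conditioning sets are nonempty, hence of positive mass.
-/
lemma isProbabilityMeasure_and_isOpenPos_prior (hpn : p ≤ n) (H : Hyperparam n p C)
    (hν : ∀ c, 0 < H.ν c) (hη : ∀ c j, H.η c j < 1) (hα : ∀ c, 0 < H.α c)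
    (ξ₀ : MixParam n p C) :
    IsProbabilityMeasure (prior H) ∧ (prior H).IsOpenPosMeasure := by
  have hSP := isOpen_stiefelPos n p
  have hOC := isOpen_orderedCone p
  have M1 : ∀ c, IsProbabilityMeasure ((ProbabilityTheory.cond
      (mlLaw (H.MM c) (H.MD c) (H.MV c)) (stiefelPos n p)).comap
        (Subtype.val : stiefelPos n p → stiefel n p)) := fun c =>
    isProbabilityMeasure_comap_cond _ hSP.measurableSet
      (hSP.measure_ne_zero _ ⟨_, (ξ₀.1 0).1.2⟩) (measure_ne_top _ _)
  have M2 : ∀ c, ((ProbabilityTheory.cond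
      (mlLaw (H.MM c) (H.MD c) (H.MV c)) (stiefelPos n p)).comap
        (Subtype.val : stiefelPos n p → stiefel n p)).IsOpenPosMeasure := fun c =>
    isOpenPosMeasure_comap_cond _ hSP.measurableSet (measure_ne_top _ _)
      fun U hU hne => (hSP.inter hU).measure_ne_zero _ hne
  have D1 : ∀ c, IsProbabilityMeasure ((ProbabilityTheory.cond (imdyLaw n (H.ν c) (H.η c))
      (orderedCone p)).comap (Subtype.val : orderedCone p → Fin p → ℝ)) := fun c => by
    refine isProbabilityMeasure_comap_cond _ hOC.measurableSet ?_ (measure_ne_top _ _)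
    have := imdyLaw_inter_ne_zero hpn (hν c) (hη c) isOpen_univ
      ⟨_, (ξ₀.1 0).2.1.2, Set.mem_univ _⟩
    rwa [Set.inter_univ] at this
  have D2 : ∀ c, ((ProbabilityTheory.cond (imdyLaw n (H.ν c) (H.η c))
      (orderedCone p)).comap (Subtype.val : orderedCone p → Fin p → ℝ)).IsOpenPosMeasure :=
    fun c => isOpenPosMeasure_comap_cond _ hOC.measurableSet (measure_ne_top _ _)
      fun U hU hne => imdyLaw_inter_ne_zero hpn (hν c) (hη c) hU hne
  have hW : dirichletBase H.α (openSimplex C) ≠ 0 := by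
    have := dirichletBase_inter_ne_zero H.α isOpen_univ ⟨_, ξ₀.2.2, Set.mem_univ _⟩
    rwa [Set.inter_univ] at this
  have hWt := (dirichletBase_openSimplex_lt_top hα).ne
  have hdir : dirichletLaw H.α = ProbabilityTheory.cond (dirichletBase H.α) (openSimplex C) := rfl
  have W1 : IsProbabilityMeasure ((dirichletLaw H.α).comap
      (Subtype.val : openSimplex C → Fin C → ℝ)) :=
    hdir ▸ isProbabilityMeasure_comap_cond _ measurableSet_openSimplex hW hWt
  have W2 : ((dirichletLaw H.α).comap
      (Subtype.val : openSimplex C → Fin C → ℝ)).IsOpenPosMeasure := by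
    rw [hdir]
    refine isOpenPosMeasure_comap_cond _ measurableSet_openSimplex hWt fun U hU hne => ?_
    exact dirichletBase_inter_ne_zero H.α hU hne
  unfold prior
  have h1 : ∀ c, (((ProbabilityTheory.cond (mlLaw (H.MM c) (H.MD c) (H.MV c))
        (stiefelPos n p)).comap (Subtype.val : stiefelPos n p → stiefel n p)).prod
      (((ProbabilityTheory.cond (imdyLaw n (H.ν c) (H.η c))
        (orderedCone p)).comap (Subtype.val : orderedCone p → Fin p → ℝ)).prod
      (mlLaw (H.VM c) (H.VD c) (H.VV c)))).IsOpenPosMeasure := fun c => inferInstance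
  have h2 := Measure.pi.isOpenPosMeasure (fun c : Fin C =>
    ((ProbabilityTheory.cond (mlLaw (H.MM c) (H.MD c) (H.MV c))
        (stiefelPos n p)).comap (Subtype.val : stiefelPos n p → stiefel n p)).prod
      (((ProbabilityTheory.cond (imdyLaw n (H.ν c) (H.η c))
        (orderedCone p)).comap (Subtype.val : orderedCone p → Fin p → ℝ)).prod
      (mlLaw (H.VM c) (H.VD c) (H.VV c))))
  exact ⟨inferInstance, inferInstance⟩

end Prior

/-! ### Exponential bounds -/

/-- From `exp y ≤ 1 + y + y²` for `|y| ≤ 1`: a negative mean pushes the Laplace transform below 1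
for small `t`. -/
lemma lintegral_exp_mul_le {α : Type*} [MeasurableSpace α] (μ : Measure α)
    [IsProbabilityMeasure μ] {Y : α → ℝ} (hY : Measurable Y) {B e t : ℝ} (hB : ∀ x, |Y x| ≤ B)
    (he : ∫ x, Y x ∂μ ≤ -e) (ht : 0 ≤ t) (htB : t * B ≤ 1) :
    ∫⁻ x, ENNReal.ofReal (Real.exp (t * Y x)) ∂μ ≤ ENNReal.ofReal (1 - t * e + (t * B) ^ 2) := by
  have hYi : Integrable Y μ :=
    Integrable.of_bound hY.aestronglyMeasurable B (ae_of_all _ hB)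
  have habs : ∀ x, |t * Y x| ≤ t * B := fun x => by
    rw [abs_mul, abs_of_nonneg ht]
    exact mul_le_mul_of_nonneg_left (hB x) ht
  have hle : ∀ x, Real.exp (t * Y x) ≤ 1 + t * Y x + (t * B) ^ 2 := fun x => by
    have h1 := (abs_le.mp (Real.abs_exp_sub_one_sub_id_le ((habs x).trans htB))).2
    have h2 : (t * Y x) ^ 2 ≤ (t * B) ^ 2 := sq_le_sq' (abs_le.mp (habs x)).1 (abs_le.mp (habs x)).2
    linarith
  have hi1 : Integrable (fun x => 1 + t * Y x) μ := (integrable_const _).add (hYi.const_mul t)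
  have hi : Integrable (fun x => 1 + t * Y x + (t * B) ^ 2) μ := hi1.add (integrable_const _)
  calc _ ≤ ∫⁻ x, ENNReal.ofReal (1 + t * Y x + (t * B) ^ 2) ∂μ :=
        lintegral_mono fun x => ENNReal.ofReal_le_ofReal (hle x)
    _ = ENNReal.ofReal (∫ x, (1 + t * Y x + (t * B) ^ 2) ∂μ) :=
        (ofReal_integral_eq_lintegral_ofReal hi
          (ae_of_all _ fun x => (Real.exp_pos _).le.trans (hle x))).symm
    _ ≤ _ := by
        refine ENNReal.ofReal_le_ofReal ?_
        rw [integral_add hi1 (integrable_const _),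
          integral_add (integrable_const _) (hYi.const_mul t), integral_const_mul]
        simp only [integral_const, probReal_univ, one_smul]
        nlinarith

/-- Markov bounds the exceptional probabilities by the summable `(ρ / r) ^ N`; Borel–Cantelli
concludes. -/
lemma ae_eventually_lt_pow_of_lintegral_le {Ω : Type*} [MeasurableSpace Ω] {P : Measure Ω}
    {F : ℕ → Ω → ℝ≥0∞} (hF : ∀ N, Measurable (F N)) {ρ r : ℝ≥0∞} (hρr : ρ < r) (hr : r ≠ ∞)
    (h : ∀ N, ∫⁻ ω, F N ω ∂P ≤ ρ ^ N) :
    ∀ᵐ ω ∂P, ∀ᶠ N in atTop, F N ω < r ^ N := by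
  have hr0 : r ≠ 0 := (bot_le.trans_lt hρr).ne'
  have hlt : ρ / r < 1 := by
    rw [ENNReal.div_lt_iff (Or.inl hr0) (Or.inl hr), one_mul]; exact hρr
  have hb : ∀ N, P {ω | r ^ N ≤ F N ω} ≤ (ρ / r) ^ N := fun N =>
    (meas_ge_le_lintegral_div (hF N).aemeasurable (pow_ne_zero _ hr0)
      (ENNReal.pow_ne_top hr)).trans <| by
        rw [div_eq_mul_inv ρ r, mul_pow, ← ENNReal.inv_pow, ← div_eq_mul_inv]
        exact ENNReal.div_le_div_right (h N) _
  have hsum : ∑' N, P {ω | r ^ N ≤ F N ω} ≠ ∞ := by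
    refine ((ENNReal.tsum_le_tsum hb).trans_lt ?_).ne
    rw [ENNReal.tsum_geometric]
    exact ENNReal.inv_lt_top.mpr (tsub_pos_of_lt hlt)
  filter_upwards [ae_eventually_notMem hsum] with ω hω
  filter_upwards [hω] with N hN
  exact not_le.mp hN

lemma lintegral_infinitePi_prod_range {α : Type*} [MeasurableSpace α] (μ : Measure α)
    [IsProbabilityMeasure μ] {h : α → ℝ≥0∞} (hh : Measurable h) (N : ℕ) :
    ∫⁻ X, ∏ i ∈ Finset.range N, h (X i) ∂(Measure.infinitePi fun _ : ℕ => μ)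
      = (∫⁻ x, h x ∂μ) ^ N := by
  have hind : iIndepFun (fun (i : ℕ) (X : ℕ → α) => h (X i))
      (Measure.infinitePi fun _ : ℕ => μ) :=
    iIndepFun_infinitePi (X := fun _ => h) fun _ => hh
  rw [lintegral_prod_eq_prod_lintegral_of_indepFun _ _ hind
    fun i => hh.comp (measurable_pi_apply i)]
  have : ∀ i : ℕ, ∫⁻ X, h (X i) ∂(Measure.infinitePi fun _ : ℕ => μ) = ∫⁻ x, h x ∂μ := fun i =>
    (measurePreserving_eval_infinitePi (fun _ : ℕ => μ) i).lintegral_comp hh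
  simp [this]

/-! ### The mixture density and the likelihood ratio -/

section Mixture

variable {n p C : ℕ}

lemma continuous_mixtureDensity (hpn : p ≤ n) :
    Continuous fun q : MixParam n p C × stiefel n p => mixtureDensity q.1 q.2 := by
  unfold mixtureDensity mlDensity
  refine continuous_finsetSum _ fun c _ => ?_
  have hθ : Continuous fun q : MixParam n p C × stiefel n p => q.1.1 c := by fun_prop
  have hM : Continuous fun q : MixParam n p C × stiefel n p => (q.1.1 c).1.1.1 :=
    continuous_subtype_val.comp (continuous_subtype_val.comp (continuous_fst.comp hθ))
  have hd : Continuous fun q : MixParam n p C × stiefel n p => (q.1.1 c).2.1.1 :=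
    continuous_subtype_val.comp (continuous_fst.comp (continuous_snd.comp hθ))
  have hV : Continuous fun q : MixParam n p C × stiefel n p => (q.1.1 c).2.2.1 :=
    continuous_subtype_val.comp (continuous_snd.comp (continuous_snd.comp hθ))
  have hX : Continuous fun q : MixParam n p C × stiefel n p => q.2.1 :=
    continuous_subtype_val.comp continuous_snd
  have hw : Continuous fun q : MixParam n p C × stiefel n p => q.1.2.1 c :=
    (continuous_apply c).comp (continuous_subtype_val.comp (continuous_snd.comp continuous_fst))
  refine hw.mul (Continuous.div (Real.continuous_exp.comp (Continuous.matrix_trace ?_))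
    ((continuous_hyp0F1 hpn).comp hd) fun q => (hyp0F1_pos hpn _).ne')
  exact ((hV.matrix_mul hd.matrix_diagonal).matrix_mul hM.matrix_transpose).matrix_mul hX

lemma continuous_mixtureDensity_right (hpn : p ≤ n) (ξ : MixParam n p C) :
    Continuous (mixtureDensity ξ) :=
  (continuous_mixtureDensity hpn).comp (Continuous.prodMk_right ξ)

lemma mixtureDensity_pos [NeZero C] (ξ : MixParam n p C) (X : stiefel n p) :
    0 < mixtureDensity ξ X :=
  Finset.sum_pos (fun c _ => mul_pos (ξ.2.2.1 c) (mlDensity_pos _ _ _ X)) Finset.univ_nonempty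

lemma likelihoodRatio_eq_prod [NeZero C] (ξ₀ ξ : MixParam n p C) (X : ℕ → stiefel n p) (N : ℕ) :
    ENNReal.ofReal (likelihoodRatio ξ₀ X N ξ) = ∏ i ∈ Finset.range N,
      ENNReal.ofReal (mixtureDensity ξ (X i) / mixtureDensity ξ₀ (X i)) :=
  ENNReal.ofReal_prod_of_nonneg fun i _ =>
    (div_pos (mixtureDensity_pos ξ (X i)) (mixtureDensity_pos ξ₀ (X i))).le

lemma measurable_likelihoodRatio (hpn : p ≤ n) (ξ₀ : MixParam n p C) (N : ℕ) :
    Measurable fun q : (ℕ → stiefel n p) × MixParam n p C => likelihoodRatio ξ₀ q.1 N q.2 := by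
  unfold likelihoodRatio
  refine Finset.measurable_prod _ fun i _ => Measurable.div ?_ ?_
  · exact (continuous_mixtureDensity hpn).measurable.comp
      (measurable_snd.prodMk ((measurable_pi_apply i).comp measurable_fst))
  · exact (continuous_mixtureDensity_right hpn ξ₀).measurable.comp
      ((measurable_pi_apply i).comp measurable_fst)

lemma measurable_evidence (hpn : p ≤ n) (Pr : Measure (MixParam n p C)) [SFinite Pr]
    (ξ₀ : MixParam n p C) (N : ℕ) (A : Set (MixParam n p C)) :
    Measurable fun X => evidence Pr ξ₀ X N A :=
  (measurable_likelihoodRatio hpn ξ₀ N).ennreal_ofReal.lintegral_prod_right'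

/-- The density ratio changes the sampling law from `ξ₀` to `ξ`. -/
lemma lintegral_mul_density_ratio [NeZero C] (hpn : p ≤ n) (ξ₀ ξ : MixParam n p C)
    {h : stiefel n p → ℝ≥0∞} (hh : Measurable h) :
    ∫⁻ x, h x * ENNReal.ofReal (mixtureDensity ξ x / mixtureDensity ξ₀ x) ∂(mixtureLaw ξ₀)
      = ∫⁻ x, h x ∂(mixtureLaw ξ) := by
  have m := fun ξ : MixParam n p C => (continuous_mixtureDensity_right hpn ξ).measurable
  have m0 := m ξ₀
  have m1 := m ξ
  rw [mixtureLaw, mixtureLaw,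
    lintegral_withDensity_eq_lintegral_mul _ m0.ennreal_ofReal (by fun_prop),
    lintegral_withDensity_eq_lintegral_mul _ m1.ennreal_ofReal hh]
  refine lintegral_congr fun x => ?_
  have h0 := mixtureDensity_pos ξ₀ x
  simp only [Pi.mul_apply]
  rw [mul_left_comm, ← ENNReal.ofReal_mul h0.le, mul_div_cancel₀ _ h0.ne', mul_comm]

/-- Fubini's theorem for the evidence. -/
lemma lintegral_prod_mul_evidence [NeZero C] (hpn : p ≤ n) (Pr : Measure (MixParam n p C))
    [SFinite Pr] (ξ₀ : MixParam n p C) (A : Set (MixParam n p C)) {h : stiefel n p → ℝ≥0∞}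
    (hh : Measurable h) (N : ℕ) :
    ∫⁻ X, (∏ i ∈ Finset.range N, h (X i)) * evidence Pr ξ₀ X N A
        ∂(Measure.infinitePi fun _ : ℕ => mixtureLaw ξ₀)
      = ∫⁻ ξ in A, (∫⁻ x, h x ∂(mixtureLaw ξ)) ^ N ∂Pr := by
  have mL := (measurable_likelihoodRatio (C := C) hpn ξ₀ N).ennreal_ofReal
  have mP : Measurable fun X : ℕ → stiefel n p => ∏ i ∈ Finset.range N, h (X i) :=
    Finset.measurable_prod _ fun i _ => hh.comp (measurable_pi_apply i)
  calc _ = ∫⁻ X, ∫⁻ ξ in A, (∏ i ∈ Finset.range N, h (X i)) *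
          ENNReal.ofReal (likelihoodRatio ξ₀ X N ξ) ∂Pr
          ∂(Measure.infinitePi fun _ : ℕ => mixtureLaw ξ₀) :=
        lintegral_congr fun X =>
          (lintegral_const_mul _ (mL.comp measurable_prodMk_left)).symm
    _ = ∫⁻ ξ in A, ∫⁻ X, (∏ i ∈ Finset.range N, h (X i)) *
          ENNReal.ofReal (likelihoodRatio ξ₀ X N ξ)
          ∂(Measure.infinitePi fun _ : ℕ => mixtureLaw ξ₀) ∂Pr :=
        lintegral_lintegral_swap ((mP.comp measurable_fst).mul mL).aemeasurable
    _ = _ := by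
        refine lintegral_congr fun ξ => ?_
        have m0 := (continuous_mixtureDensity_right hpn ξ₀).measurable
        have m1 := (continuous_mixtureDensity_right hpn ξ).measurable
        simp only [likelihoodRatio_eq_prod, ← Finset.prod_mul_distrib]
        rw [lintegral_infinitePi_prod_range (mixtureLaw ξ₀) (h := fun x => h x *
          ENNReal.ofReal (mixtureDensity ξ x / mixtureDensity ξ₀ x)) (by fun_prop),
          lintegral_mul_density_ratio hpn ξ₀ ξ hh]

/-- The evidence is almost surely finite. -/
lemma ae_evidence_lt_top [NeZero C] (hpn : p ≤ n) (Pr : Measure (MixParam n p C))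
    [IsFiniteMeasure Pr] (ξ₀ : MixParam n p C) :
    ∀ᵐ X ∂(Measure.infinitePi fun _ : ℕ => mixtureLaw ξ₀), ∀ N, evidence Pr ξ₀ X N Set.univ < ∞ := by
  refine ae_all_iff.mpr fun N => ae_lt_top (measurable_evidence hpn Pr ξ₀ N _) ?_
  -- With `h = 1`, the expected evidence is the total mass of the prior.
  have := lintegral_prod_mul_evidence hpn Pr ξ₀ Set.univ (h := fun _ => 1) measurable_const N
  simp only [Finset.prod_const_one, one_mul, lintegral_const, measure_univ, one_pow,
    Measure.restrict_univ] at this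
  rw [this]
  exact measure_ne_top _ _

/-- If the prior has full support, the evidence decays slower than any exponential. -/
lemma exists_mul_pow_le_evidence [NeZero C] (hpn : p ≤ n) (Pr : Measure (MixParam n p C))
    [Pr.IsOpenPosMeasure] (ξ₀ : MixParam n p C) {q : ℝ} (hq0 : 0 < q) (hq : q < 1) :
    ∃ m : ℝ≥0∞, m ≠ 0 ∧ ∀ X N, m * ENNReal.ofReal q ^ N ≤ evidence Pr ξ₀ X N Set.univ := by
  -- Tube lemma: the strict inequality holds near each `(ξ₀, x)`, and compactness yields one
  -- neighbourhood of `ξ₀` valid for all `x`.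
  have hB : ∀ᶠ ξ in 𝓝 ξ₀, ∀ x ∈ (Set.univ : Set (stiefel n p)),
      q * mixtureDensity ξ₀ x < mixtureDensity ξ x := by
    refine isCompact_univ.eventually_forall_of_forall_eventually fun x _ => ?_
    refine ContinuousAt.eventually_lt ?_ (continuous_mixtureDensity hpn).continuousAt
      (mul_lt_of_lt_one_left (mixtureDensity_pos ξ₀ x) hq)
    exact (continuous_const.mul
      ((continuous_mixtureDensity_right hpn ξ₀).comp continuous_snd)).continuousAt
  obtain ⟨B, hB, hBo, hBm⟩ := mem_nhds_iff.mp hB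
  refine ⟨Pr B, hBo.measure_ne_zero _ ⟨_, hBm⟩, fun X N => ?_⟩
  calc Pr B * ENNReal.ofReal q ^ N = ∫⁻ _ in B, ENNReal.ofReal q ^ N ∂Pr := by
        rw [setLIntegral_const, mul_comm]
    _ ≤ ∫⁻ ξ in B, ENNReal.ofReal (likelihoodRatio ξ₀ X N ξ) ∂Pr := by
        refine setLIntegral_mono' hBo.measurableSet fun ξ hξ => ?_
        rw [← ENNReal.ofReal_pow hq0.le]
        refine ENNReal.ofReal_le_ofReal ?_
        rw [likelihoodRatio, ← Finset.card_range N, ← Finset.prod_const, Finset.card_range]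
        refine Finset.prod_le_prod (fun _ _ => hq0.le) fun i _ => ?_
        rw [le_div_iff₀ (mixtureDensity_pos _ _)]
        exact (hB hξ _ trivial).le
    _ ≤ _ := lintegral_mono_set (Set.subset_univ _)

end Mixture

/-! ### Decay of the posterior off weak neighbourhoods -/

section Posterior

variable {n p C : ℕ}

lemma integral_mixtureLaw [NeZero C] (hpn : p ≤ n) (ξ : MixParam n p C) (g : stiefel n p → ℝ) :
    ∫ x, g x ∂(mixtureLaw ξ) = ∫ x, g x * mixtureDensity ξ x ∂(stiefelHaar n p) := by
  rw [mixtureLaw, integral_withDensity_eq_integral_toReal_smul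
    (continuous_mixtureDensity_right hpn ξ).measurable.ennreal_ofReal
    (ae_of_all _ fun _ => ENNReal.ofReal_lt_top)]
  refine integral_congr_ae (ae_of_all _ fun x => ?_)
  simp only [smul_eq_mul]
  rw [ENNReal.toReal_ofReal (mixtureDensity_pos ξ x).le, mul_comm]

/-- The parameters under which the mean of `g` exceeds that under `ξ₀` by at least `ε`. -/
def upperHalf (ξ₀ : MixParam n p C) (g : stiefel n p →ᵇ ℝ) (ε : ℝ) : Set (MixParam n p C) :=
  {ξ | ∫ x, g x ∂(mixtureLaw ξ₀) + ε ≤ ∫ x, g x ∂(mixtureLaw ξ)}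

lemma measurableSet_upperHalf [NeZero C] (hpn : p ≤ n) (ξ₀ : MixParam n p C)
    (g : stiefel n p →ᵇ ℝ) (ε : ℝ) : MeasurableSet (upperHalf ξ₀ g ε) := by
  have := isProbabilityMeasure_stiefelHaar hpn
  refine measurableSet_le measurable_const ?_
  simp only [integral_mixtureLaw hpn]
  have : StronglyMeasurable fun q : MixParam n p C × stiefel n p =>
      g q.2 * mixtureDensity q.1 q.2 :=
    ((g.continuous.comp continuous_snd).mul (continuous_mixtureDensity hpn)).stronglyMeasurable
  exact this.integral_prod_right'.measurable

/-- The evidence of `upperHalf` decays exponentially. -/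
lemma ae_evidence_upperHalf_lt [NeZero C] (hpn : p ≤ n) (Pr : Measure (MixParam n p C))
    [IsProbabilityMeasure Pr] (ξ₀ : MixParam n p C) (g : stiefel n p →ᵇ ℝ) {ε : ℝ} (hε : 0 < ε) :
    ∃ r : ℝ, 0 < r ∧ r < 1 ∧ ∀ᵐ X ∂(Measure.infinitePi fun _ : ℕ => mixtureLaw ξ₀),
      ∀ᶠ N in atTop, evidence Pr ξ₀ X N (upperHalf ξ₀ g ε) ≤ ENNReal.ofReal r ^ N := by
  set m := ∫ x, g x ∂(mixtureLaw ξ₀) with hm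
  set B : ℝ := 2 * ‖g‖ + ε
  have hB0 : 0 < B := by positivity
  have hεB : ε ≤ B := by have := norm_nonneg g; simp only [B]; linarith
  -- The minimizer of `1 - t ε/2 + (t B)²`, with minimum `1 - (ε/B)²/16`.
  set t : ℝ := ε / (4 * B ^ 2) with ht
  have ht0 : 0 < t := by positivity
  set u : ℝ := ε / B with hu
  have hu0 : 0 < u := by positivity
  have hu1 : u ≤ 1 := (div_le_one hB0).mpr hεB
  have htB : t * B = u / 4 := by rw [ht, hu]; field_simp
  have htε : t * (ε / 2) = u ^ 2 / 8 := by rw [ht, hu]; field_simp; norm_num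
  set ρ : ℝ := 1 - t * (ε / 2) + (t * B) ^ 2 with hρ
  have hρe : ρ = 1 - u ^ 2 / 16 := by rw [hρ, htε, htB]; ring
  have hρ1 : ρ < 1 := by rw [hρe]; have := pow_pos hu0 2; linarith
  have hρ0 : 0 < ρ := by rw [hρe]; nlinarith
  obtain ⟨r, hρr, hr1⟩ := exists_between hρ1
  have hr0 := hρ0.trans hρr
  have hgi : ∀ ξ : MixParam n p C, Integrable g (mixtureLaw ξ) := fun ξ => g.integrable _
  have hmB : |m| ≤ ‖g‖ := by
    have := norm_integral_le_of_norm_le_const (μ := mixtureLaw ξ₀)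
      (ae_of_all _ fun x => g.norm_coe_le_norm x)
    simpa using this
  -- Centring halfway gives mean `ε/2` under `ξ₀` and at most `-ε/2` on `upperHalf`, so one `t`
  -- serves for both `Y` and `-Y`.
  set Y : stiefel n p → ℝ := fun x => m + ε / 2 - g x with hYdef
  have hYc : Continuous Y := continuous_const.sub g.continuous
  have hYm := hYc.measurable
  have hYB : ∀ x, |Y x| ≤ B := fun x => by
    have h1 := abs_le.mp (g.norm_coe_le_norm x)
    have h2 := abs_le.mp hmB
    rw [abs_le]
    constructor <;> simp only [hYdef, B] <;> linarith [h1.1, h1.2, h2.1, h2.2]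
  have hYint : ∀ ξ : MixParam n p C,
      ∫ x, Y x ∂(mixtureLaw ξ) = m + ε / 2 - ∫ x, g x ∂(mixtureLaw ξ) := fun ξ => by
    simp only [hYdef]
    rw [integral_sub (integrable_const _) (hgi ξ)]
    simp
  set h : stiefel n p → ℝ≥0∞ := fun x => ENNReal.ofReal (Real.exp (t * Y x)) with hh
  set k : stiefel n p → ℝ≥0∞ := fun x => ENNReal.ofReal (Real.exp (t * -Y x)) with hk
  have hhm : Measurable h := by fun_prop
  have hkm : Measurable k := by fun_prop
  have hhk : ∀ x, h x * k x = 1 := fun x => by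
    rw [hh, hk, ← ENNReal.ofReal_mul (Real.exp_pos _).le, ← Real.exp_add]
    simp
  have hA : ∀ ξ ∈ upperHalf ξ₀ g ε, ∫⁻ x, h x ∂(mixtureLaw ξ) ≤ ENNReal.ofReal ρ := fun ξ hξ => by
    refine lintegral_exp_mul_le _ hYm hYB ?_ ht0.le (by rw [htB]; linarith)
    have : m + ε ≤ ∫ x, g x ∂(mixtureLaw ξ) := hξ
    rw [hYint]; linarith
  have h0 : ∫⁻ x, k x ∂(mixtureLaw ξ₀) ≤ ENNReal.ofReal ρ := by
    refine lintegral_exp_mul_le _ hYm.neg (fun x => (abs_neg (Y x)).trans_le (hYB x)) ?_ ht0.le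
      (by rw [htB]; linarith)
    simp only [Pi.neg_apply]
    rw [integral_neg, hYint, ← hm]; linarith
  have mprod : ∀ {f : stiefel n p → ℝ≥0∞}, Measurable f → ∀ N : ℕ,
      Measurable fun X : ℕ → stiefel n p => ∏ i ∈ Finset.range N, f (X i) := fun hf N =>
    Finset.measurable_prod _ fun i _ => hf.comp (measurable_pi_apply i)
  have hρr' : ENNReal.ofReal ρ < ENNReal.ofReal r := (ENNReal.ofReal_lt_ofReal_iff hr0).mpr hρr
  have E1 := ae_eventually_lt_pow_of_lintegral_le
    (P := Measure.infinitePi fun _ : ℕ => mixtureLaw ξ₀)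
    (F := fun N X => (∏ i ∈ Finset.range N, h (X i)) * evidence Pr ξ₀ X N (upperHalf ξ₀ g ε))
    (fun N => (mprod hhm N).mul (measurable_evidence hpn Pr ξ₀ N _)) hρr' ENNReal.ofReal_ne_top
    fun N => by
      rw [lintegral_prod_mul_evidence hpn Pr ξ₀ _ hhm N]
      calc _ ≤ ∫⁻ _ in upperHalf ξ₀ g ε, ENNReal.ofReal ρ ^ N ∂Pr :=
            setLIntegral_mono' (measurableSet_upperHalf hpn ξ₀ g ε) fun ξ hξ =>
              pow_le_pow_left' (hA ξ hξ) N
        _ ≤ ENNReal.ofReal ρ ^ N := by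
            rw [setLIntegral_const]
            exact mul_le_of_le_one_right' prob_le_one
  have E2 := ae_eventually_lt_pow_of_lintegral_le
    (P := Measure.infinitePi fun _ : ℕ => mixtureLaw ξ₀)
    (F := fun N X => ∏ i ∈ Finset.range N, k (X i)) (mprod hkm) hρr' ENNReal.ofReal_ne_top
    fun N => by
      rw [lintegral_infinitePi_prod_range _ hkm]
      exact pow_le_pow_left' h0 N
  refine ⟨r * r, by positivity, by nlinarith, ?_⟩
  filter_upwards [E1, E2] with X hX1 hX2
  filter_upwards [hX1, hX2] with N h1 h2
  -- The weights `h` and `k` are inverse to each other, so multiplying the two bounds leaves the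
  -- evidence alone.
  calc _ = ((∏ i ∈ Finset.range N, h (X i)) * evidence Pr ξ₀ X N (upperHalf ξ₀ g ε)) *
        ∏ i ∈ Finset.range N, k (X i) := by
        rw [mul_right_comm, ← Finset.prod_mul_distrib]
        simp [hhk]
    _ ≤ ENNReal.ofReal r ^ N * ENNReal.ofReal r ^ N := mul_le_mul' h1.le h2.le
    _ = _ := by rw [← mul_pow, ENNReal.ofReal_mul hr0.le]

/-- The numerator is eventually at most `r ^ N`; a lower bound `m * q ^ N` with `r < q < 1` makes
the quotient geometric. -/
lemma ae_tendsto_posterior_upperHalf [NeZero C] (hpn : p ≤ n) (Pr : Measure (MixParam n p C))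
    [IsProbabilityMeasure Pr] [Pr.IsOpenPosMeasure] (ξ₀ : MixParam n p C)
    (g : stiefel n p →ᵇ ℝ) {ε : ℝ} (hε : 0 < ε) :
    ∀ᵐ X ∂(Measure.infinitePi fun _ : ℕ => mixtureLaw ξ₀),
      Tendsto (fun N => posterior Pr ξ₀ X N (upperHalf ξ₀ g ε)) atTop (𝓝 0) := by
  obtain ⟨r, hr0, hr1, hr⟩ := ae_evidence_upperHalf_lt hpn Pr ξ₀ g hε
  obtain ⟨q, hrq, hq1⟩ := exists_between hr1
  have hq0 := hr0.trans hrq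
  obtain ⟨m, hm, hle⟩ := exists_mul_pow_le_evidence hpn Pr ξ₀ hq0 hq1
  filter_upwards [hr] with X hX
  have hlim : Tendsto (fun N : ℕ => m⁻¹ * ENNReal.ofReal (r / q) ^ N) atTop (𝓝 0) := by
    have h1 : ENNReal.ofReal (r / q) < 1 := ENNReal.ofReal_lt_one.mpr ((div_lt_one hq0).mpr hrq)
    have := ENNReal.Tendsto.const_mul (a := m⁻¹) (ENNReal.tendsto_pow_atTop_nhds_zero_of_lt_one h1)
      (Or.inr (ENNReal.inv_ne_top.mpr hm))
    rwa [mul_zero] at this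
  refine tendsto_of_tendsto_of_tendsto_of_le_of_le' tendsto_const_nhds hlim
    (Eventually.of_forall fun _ => bot_le) ?_
  filter_upwards [hX] with N hN
  calc _ ≤ ENNReal.ofReal r ^ N / (m * ENNReal.ofReal q ^ N) := ENNReal.div_le_div hN (hle X N)
    _ = _ := by
      have hq' : ENNReal.ofReal q ^ N ≠ 0 := pow_ne_zero _ (ENNReal.ofReal_pos.mpr hq0).ne'
      rw [ENNReal.ofReal_div_of_pos hq0, div_eq_mul_inv, div_eq_mul_inv, mul_pow,
        ENNReal.mul_inv (Or.inl hm) (Or.inr hq'), ENNReal.inv_pow]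
      ring

/-- A two-sided deviation of the mean of `g` is a one-sided one for `g` or for `-g`. -/
lemma compl_weakBall_subset [NeZero C] (hpn : p ≤ n) (ξ₀ : MixParam n p C)
    (G : Finset (stiefel n p →ᵇ ℝ)) (ε : ℝ) :
    (weakBall ξ₀ G ε)ᶜ ⊆ ⋃ g ∈ G, upperHalf ξ₀ g ε ∪ upperHalf ξ₀ (-g) ε := by
  intro ξ hξ
  simp only [weakBall, Set.mem_compl_iff, Set.mem_ofPred_eq, not_forall, not_lt,
    ← integral_mixtureLaw hpn] at hξ
  obtain ⟨g, hg, h⟩ := hξ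
  refine Set.mem_biUnion hg ?_
  simp only [upperHalf, Set.mem_union, Set.mem_ofPred_eq, BoundedContinuousFunction.coe_neg,
    Pi.neg_apply, integral_neg]
  rcases le_abs.mp h with h | h
  · right; linarith
  · left; linarith

/-- Monotonicity and subadditivity in the domain hold for arbitrary sets; this matters because a
weak neighbourhood need not be measurable. -/
lemma posterior_le_sum (Pr : Measure (MixParam n p C)) (ξ₀ : MixParam n p C)
    (X : ℕ → stiefel n p) (N : ℕ) {A : Set (MixParam n p C)} {ι : Type*} (G : Finset ι)
    (S T : ι → Set (MixParam n p C)) (hA : A ⊆ ⋃ g ∈ G, S g ∪ T g) :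
    posterior Pr ξ₀ X N A ≤ ∑ g ∈ G, (posterior Pr ξ₀ X N (S g) + posterior Pr ξ₀ X N (T g)) := by
  simp only [posterior, div_eq_mul_inv, ← add_mul, ← Finset.sum_mul]
  refine mul_le_mul_left ?_ _
  calc evidence Pr ξ₀ X N A ≤ evidence Pr ξ₀ X N (⋃ g ∈ G, S g ∪ T g) := lintegral_mono_set hA
    _ ≤ ∑ g ∈ G, evidence Pr ξ₀ X N (S g ∪ T g) := by
        rw [show (⋃ g ∈ G, S g ∪ T g) = ⋃ g : G, S g ∪ T g from Set.biUnion_eq_iUnion _ _]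
        refine (lintegral_iUnion_le _ _).trans_eq ?_
        rw [tsum_fintype]
        exact Finset.sum_coe_sort G fun g => evidence Pr ξ₀ X N (S g ∪ T g)
    _ ≤ _ := Finset.sum_le_sum fun g _ => lintegral_union_le _ _ _

end Posterior

end MatrixLangevin

open MatrixLangevin in
theorem mainTheorem5 (n p C : ℕ) [NeZero C] (hp : 1 ≤ p) (hpn : p ≤ n)
    (H : MatrixLangevin.Hyperparam n p C)
    (hν : ∀ c, 0 < H.ν c) (hη : ∀ c j, H.η c j < 1) (hα : ∀ c, 0 < H.α c)
    (ξ₀ : MatrixLangevin.MixParam n p C)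
    (U : Set (MatrixLangevin.MixParam n p C)) (hU : MatrixLangevin.IsWeakNhd ξ₀ U) :
    ∀ᵐ X ∂(Measure.infinitePi fun _ : ℕ => MatrixLangevin.mixtureLaw ξ₀),
      (∀ N : ℕ, 0 < MatrixLangevin.evidence (MatrixLangevin.prior H) ξ₀ X N Set.univ ∧
        MatrixLangevin.evidence (MatrixLangevin.prior H) ξ₀ X N Set.univ < ∞) ∧
      Tendsto (fun N : ℕ => MatrixLangevin.posterior (MatrixLangevin.prior H) ξ₀ X N Uᶜ)
        atTop (𝓝 0) := by
  obtain ⟨_, _⟩ := isProbabilityMeasure_and_isOpenPos_prior hpn H hν hη hα ξ₀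
  obtain ⟨G, ε, hε, hGU⟩ := hU
  -- Any `q` in `(0, 1)` would do: only positivity of the evidence is drawn from this bound.
  obtain ⟨m, hm, hle⟩ := exists_mul_pow_le_evidence hpn (prior H) ξ₀ (q := 1 / 2)
    (by norm_num) (by norm_num)
  have hG : ∀ᵐ X ∂(Measure.infinitePi fun _ : ℕ => mixtureLaw ξ₀), ∀ g ∈ G,
      Tendsto (fun N => posterior (prior H) ξ₀ X N (upperHalf ξ₀ g ε)
        + posterior (prior H) ξ₀ X N (upperHalf ξ₀ (-g) ε)) atTop (𝓝 0) := by
    refine (Finset.eventually_all G).mpr fun g _ => ?_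
    filter_upwards [ae_tendsto_posterior_upperHalf hpn (prior H) ξ₀ g hε,
      ae_tendsto_posterior_upperHalf hpn (prior H) ξ₀ (-g) hε] with X h1 h2
    simpa using h1.add h2
  filter_upwards [ae_evidence_lt_top hpn (prior H) ξ₀, hG] with X hfin hX
  refine ⟨fun N => ⟨lt_of_lt_of_le ?_ (hle X N), hfin N⟩, ?_⟩
  · exact pos_iff_ne_zero.mpr (mul_ne_zero hm (pow_ne_zero _ (by simp)))
  · have hsum := tendsto_finsetSum G hX
    rw [Finset.sum_const_zero] at hsum
    refine tendsto_of_tendsto_of_tendsto_of_le_of_le tendsto_const_nhds hsum (fun _ => bot_le)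
      fun N => ?_
    exact posterior_le_sum _ ξ₀ X N G _ _
      ((Set.compl_subset_compl.mpr hGU).trans (compl_weakBall_subset hpn ξ₀ G ε))
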